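/- Let $C_0=\{(x,t)\in\mathbb R^{3}\times\mathbb R: t=|x|\}$ be the future null cone at the origin of Minkowski space $(\mathbb R^{3,1},\eta)$, $\eta=|dx|^2-dt^2$. Away from its vertex use polar coordinates $(r,\theta)\in\mathbb R^+\times S^2$, where $x=r\theta$, $r=|x|>0$, $S^2=\{\theta\in\mathbb R^3:|\theta|=1\}$; the degenerate form induced by $\eta$ is $ds^2_{C_0}=r^2|d\theta|^2$. For $r>0$ let $i_r:S^2\to C_0$, $i_r(\theta)=(r\theta,r)$. A map $\Phi:C_0\to C_0$ is called a $C^\infty$ quasi-spherical map if it is $C^\infty$ away from the vertex and if, for every $r>0$, $\Phi_r=\Phi\circ i_r:S^2\to C_0$ is an orientation preserving embedding with $\Phi_r^*(ds^2_{C_0})=r^2|d\theta|^2$. (Orientation: $S^2$ is oriented by its outer normal $\theta$; $C_0$ has the orientation of the coordinate $x\in\mathbb R^3$, and $\Phi_r(S^2)$ is oriented by the outgoing generators of the cone.) For $w\in\mathbb R^3$ put $b=\sqrt{1+|w|^2}$ and $W=I+\frac1{b+1}ww^T$, and consider the Lorentz transformations $$\mathcal R(R)=\begin{pmatrix}R&0\\0&1\end{pmatrix}\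 (R\in SO(3)),\qquad \mathcal B(w)=\begin{pmatrix}W&w\\w^T&b\end{pmatrix}.$$ Let $\Phi:C_0\to C_0$ be a $C^\infty$ quasi-spherical map. Then there are $w\in C^\infty(\mathbb R^+,\mathbb R^3)$ and $R\in C^\infty(\mathbb R^+,SO(3))$ such that: 1. For all $r>0$ and $\theta\in S^2$, with $w=w(r)$, $R=R(r)$, $$\Phi(r\theta,r)=\mathcal R(R)\,\mathcal B(w)\begin{pmatrix}r\theta\\ r\end{pmatrix}=\begin{pmatrix} rR\theta+r\bigl(1+\frac{\theta^Tw}{b+1}\bigr)Rw\\ r(b+\theta^Tw)\end{pmatrix}.$$ 2. In the coordinates $(r,\theta)$, for $r>0$, $$\Phi^*(ds^2_{C_0})=|r\,d\theta+\beta\,dr|^2,\qquad \beta(r,\theta)=r\,\Theta t_1+r\,\theta\times s_1,$$ where $\Theta=I-\theta\theta^T$ and, with subscript $,r$ denoting $d/dr$, $$S_1=WR^{-1}R_{,r}W,\qquad s_1={*S_1}+\tfrac1{b+1}\,w_{,r}\times w,\qquad t_1=b^{-1}S_1w+W^{-1}w_{,r},\qquad ({*S})_i=\tfrac12\epsilon_{ijk}S_{jk}.$$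 3. For each $r>0$ the vector field $\beta(r,\cdot)$ on $S^2$ consists purely of $\ell=1$ spin-1 spherical harmonics: it is tangent to $S^2$, and there is $F\in C^\infty(S^2,\mathbb C)$ with $\Delta_{S^2}F=-\ell(\ell+1)F$, $\ell=1$, such that for every $\theta\in S^2$ and every orthonormal frame $(e_1,e_2)$ of $T_\theta S^2$ with $e_1\times e_2=\theta$, $$\tfrac1{\sqrt2}\bigl(\beta\cdot e_1-\mathrm i\,\beta\cdot e_2\bigr)=\eth F:=\tfrac1{\sqrt2}\bigl(\nabla_{e_1}F-\mathrm i\,\nabla_{e_2}F\bigr).$$ -/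

import Mathlib

open scoped ContDiff Matrix

noncomputable section

namespace NullCone

/-! ### Minkowski space, the future null cone, the unit sphere -/

/-- Euclidean three-space. -/
abbrev E3 : Type := EuclideanSpace ℝ (Fin 3)

/-- The vector space underlying Minkowski space `ℝ^{3,1}`; points are pairs `(x, t)`. -/
abbrev Mink : Type := E3 × ℝ

/-- The Minkowski metric `η = |dx|² - dt²`, as a bilinear form. -/
def eta (p q : Mink) : ℝ := inner ℝ p.1 q.1 - p.2 * q.2

/-- The unit sphere `S²` in `ℝ³`. -/
abbrev S2 : Type := Metric.sphere (0 : E3) 1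

/-- The standard future null cone `C₀ = {(x, t) : t = |x|}`. -/
abbrev Cone : Type := {p : Mink // p.2 = ‖p.1‖}

/-- The point of the cone with spatial coordinate `x`. -/
def conePoint (x : E3) : Cone := ⟨(x, ‖x‖), rfl⟩

/-- The inclusion `i_r : S² → C₀`, `θ ↦ (rθ, r)` (used for `r > 0`, where `|rθ| = r`). -/
def iota (r : ℝ) (θ : S2) : Cone := conePoint (r • (θ : E3))

/-- Cross product on `ℝ³`. -/
def cross (x y : E3) : E3 := WithLp.toLp 2 (x.ofLp ⨯₃ y.ofLp)

/-- A `3 × 3` matrix acting on a vector of `ℝ³`. -/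
def mv (A : Matrix (Fin 3) (Fin 3) ℝ) (x : E3) : E3 := WithLp.toLp 2 (A *ᵥ x.ofLp)

/-! ### Calculus on the sphere

Tangent vectors of `S²` at `θ` are the vectors `v` of `ℝ³` with `⟪θ, v⟫ = 0`.  Functions on `S²`
are differentiated through their extensions to `ℝ³ ∖ {0}` that are homogeneous of degree `0`. -/

/-- The extension `x ↦ f (x / |x|)` of a function on `S²` (with value `0` at the origin). -/
def radialExt {V : Type*} [Zero V] (f : S2 → V) (x : E3) : V :=
  open Classical in
  if h : x ≠ 0 then f ⟨‖x‖⁻¹ • x, by simp [norm_smul, h]⟩ else 0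

/-- Smoothness of a vector-valued function on `S²`. -/
def SphereSmooth {V : Type*} [NormedAddCommGroup V] [NormedSpace ℝ V] (f : S2 → V) : Prop :=
  ContDiffOn ℝ ∞ (radialExt f) {0}ᶜ

/-- The differential at `θ`, along `v`, of a vector-valued function on `S²`. -/
def sphereDeriv {V : Type*} [NormedAddCommGroup V] [NormedSpace ℝ V]
    (f : S2 → V) (θ : S2) (v : E3) : V :=
  fderiv ℝ (radialExt f) (θ : E3) v

/-- The Laplace-Beltrami operator of `S²`. -/
def sphereLaplacian (f : S2 → ℂ) (θ : S2) : ℂ :=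
  Laplacian.laplacian (radialExt f) (θ : E3)

/-! ### Quasi-spherical maps -/

/-- `f : S² → C₀` is a quasi-spherical map of radius `r`: a smooth orientation preserving embedding
which pulls back the degenerate form induced on `C₀` by the Minkowski metric to `r² |dθ|²`. -/
structure IsQuasiSphere (r : ℝ) (f : S2 → Cone) : Prop where
  smooth : SphereSmooth fun θ => (f θ : Mink)
  embedding : Topology.IsEmbedding f
  immersion : ∀ (θ : S2) (v : E3), inner ℝ (θ : E3) v = 0 →
    sphereDeriv (fun θ => (f θ : Mink)) θ v = 0 → v = 0
  /-- `C₀` carries the orientation of its spatial coordinate `x`; the image of `f` is oriented by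
  the outgoing null generators, whose spatial direction at a point is its coordinate `x`, just as
  `S²` is oriented by its outer normal `θ`. -/
  orientation : ∀ (θ : S2) (u v : E3), inner ℝ (θ : E3) u = 0 → inner ℝ (θ : E3) v = 0 →
    0 < inner ℝ (θ : E3) (cross u v) →
    0 < inner ℝ (f θ : Mink).1
      (cross (sphereDeriv (fun θ => (f θ : Mink)) θ u).1
        (sphereDeriv (fun θ => (f θ : Mink)) θ v).1)
  metric : ∀ (θ : S2) (u v : E3), inner ℝ (θ : E3) u = 0 → inner ℝ (θ : E3) v = 0 →
    eta (sphereDeriv (fun θ => (f θ : Mink)) θ u) (sphereDeriv (fun θ => (f θ : Mink)) θ v)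
      = r ^ 2 * inner ℝ u v

/-- A smooth quasi-spherical map `Φ : C₀ → C₀`: it is smooth away from the vertex of the cone
(in the coordinate `x`), and `Φ ∘ i_r` is a quasi-spherical map of radius `r` for all `r > 0`. -/
structure IsSmoothQuasiSpherical (Φ : Cone → Cone) : Prop where
  smooth : ContDiffOn ℝ ∞ (fun x : E3 => (Φ (conePoint x) : Mink)) {0}ᶜ
  quasiSphere : ∀ r : ℝ, 0 < r → IsQuasiSphere r (fun θ => Φ (iota r θ))

/-- The differential of `Φ` in the polar coordinates `(r, θ)` of `C₀`, applied to the tangent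
vector with `dr = a` and `dθ = v`. -/
def polarDeriv (Φ : Cone → Cone) (r : ℝ) (θ : S2) (a : ℝ) (v : E3) : Mink :=
  a • deriv (fun s : ℝ => (Φ (iota s θ) : Mink)) r
    + sphereDeriv (fun θ' => (Φ (iota r θ') : Mink)) θ v

/-- The pulled-back form `Φ^*(ds²_{C₀})` at `(r, θ)`, in polar coordinates. -/
def pullbackForm (Φ : Cone → Cone) (r : ℝ) (θ : S2) (X Y : ℝ × E3) : ℝ :=
  eta (polarDeriv Φ r θ X.1 X.2) (polarDeriv Φ r θ Y.1 Y.2)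

/-! ### Lorentz boosts and rotations -/

/-- `b = √(1 + |w|²)`. -/
def boostB (w : E3) : ℝ := Real.sqrt (1 + ‖w‖ ^ 2)

/-- The matrix `W = I + (b + 1)⁻¹ w wᵀ`. -/
def boostW (w : E3) : Matrix (Fin 3) (Fin 3) ℝ :=
  1 + (1 / (boostB w + 1)) • Matrix.vecMulVec w.ofLp w.ofLp

/-- The boost with block matrix `[[W, w], [wᵀ, b]]`. -/
def boost (w : E3) (p : Mink) : Mink :=
  (mv (boostW w) p.1 + p.2 • w, inner ℝ w p.1 + boostB w * p.2)

/-- The rotation with block matrix `[[R, 0], [0, 1]]`. -/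
def rotation (R : Matrix (Fin 3) (Fin 3) ℝ) (p : Mink) : Mink := (mv R p.1, p.2)

/-! ### The shear vector -/

/-- The entrywise derivative of a matrix-valued function. -/
def matDeriv (R : ℝ → Matrix (Fin 3) (Fin 3) ℝ) (r : ℝ) : Matrix (Fin 3) (Fin 3) ℝ :=
  Matrix.of fun i j => deriv (fun s => R s i j) r

/-- `(*S)_i = ½ ε_{ijk} S_{jk}`. -/
def star3 (S : Matrix (Fin 3) (Fin 3) ℝ) : E3 :=
  !₂[(S 1 2 - S 2 1) / 2, (S 2 0 - S 0 2) / 2, (S 0 1 - S 1 0) / 2]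

/-- `S₁ = W R⁻¹ R_{,r} W`. -/
def S₁ (w : ℝ → E3) (R : ℝ → Matrix (Fin 3) (Fin 3) ℝ) (r : ℝ) : Matrix (Fin 3) (Fin 3) ℝ :=
  boostW (w r) * (R r)⁻¹ * matDeriv R r * boostW (w r)

/-- `s₁ = *S₁ + (b + 1)⁻¹ w_{,r} × w`. -/
def s₁ (w : ℝ → E3) (R : ℝ → Matrix (Fin 3) (Fin 3) ℝ) (r : ℝ) : E3 :=
  star3 (S₁ w R r) + (1 / (boostB (w r) + 1)) • cross (deriv w r) (w r)

/-- `t₁ = b⁻¹ S₁ w + W⁻¹ w_{,r}`. -/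
def t₁ (w : ℝ → E3) (R : ℝ → Matrix (Fin 3) (Fin 3) ℝ) (r : ℝ) : E3 :=
  (boostB (w r))⁻¹ • mv (S₁ w R r) (w r) + mv (boostW (w r))⁻¹ (deriv w r)

/-- `Θ t = t - (θᵀ t) θ`, the projection of `t` tangent to `S²` at `θ`. -/
def tangentProj (θ : S2) (t : E3) : E3 := t - inner ℝ (θ : E3) t • (θ : E3)

/-- The shear vector `β = r Θ t₁ + r θ × s₁`. -/
def shear (w : ℝ → E3) (R : ℝ → Matrix (Fin 3) (Fin 3) ℝ) (r : ℝ) (θ : S2) : E3 :=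
  r • tangentProj θ (t₁ w R r) + r • cross (θ : E3) (s₁ w R r)

/-! ### Spin-1 spherical harmonics -/

/-- `(e₁, e₂)` is an orthonormal frame of the tangent plane at `θ` with `e₁ × e₂ = θ`. -/
structure IsOrientedFrame (θ : S2) (e₁ e₂ : E3) : Prop where
  norm_one : ‖e₁‖ = 1
  norm_two : ‖e₂‖ = 1
  orthogonal : inner ℝ e₁ e₂ = 0
  oriented : cross e₁ e₂ = (θ : E3)

/-- The spin-1 component `ξ = (X¹ - i X²) / √2` of the tangent vector `X = X¹ e₁ + X² e₂`. -/
def spinComponent (e₁ e₂ X : E3) : ℂ :=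
  ((inner ℝ X e₁ : ℝ) - Complex.I * (inner ℝ X e₂ : ℝ)) / (Real.sqrt 2 : ℝ)

/-- The operator `ð = (∇_{e₁} - i ∇_{e₂}) / √2` on functions. -/
def eth (F : S2 → ℂ) (θ : S2) (e₁ e₂ : E3) : ℂ :=
  (sphereDeriv F θ e₁ - Complex.I * sphereDeriv F θ e₂) / (Real.sqrt 2 : ℝ)

/-- The vector field `X` on `S²` is a spin-1 spherical harmonic of degree `ℓ`: it is tangent to
`S²`, and its spin-1 component is `ð F` for a smooth function `F` with `ΔF = -ℓ(ℓ+1) F`. -/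
def IsSpinOneHarmonic (ℓ : ℕ) (X : S2 → E3) : Prop :=
  (∀ θ : S2, inner ℝ (θ : E3) (X θ) = 0) ∧
  ∃ F : S2 → ℂ, SphereSmooth F ∧
    (∀ θ : S2, sphereLaplacian F θ = -((ℓ : ℂ) * ((ℓ : ℂ) + 1)) * F θ) ∧
    ∀ (θ : S2) (e₁ e₂ : E3), IsOrientedFrame θ e₁ e₂ →
      spinComponent e₁ e₂ (X θ) = eth F θ e₁ e₂

end NullCone

end

noncomputable section

namespace NullCone

/-! The core is a rigidity statement at fixed radius: every quasi-sphere is the image of the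
standard sphere under a proper orthochronous Lorentz transformation. Extend `f` to the degree-one
homogeneous map `coneExt`, which preserves the degenerate metric of the cone. The null hyperplane `t
+ x₂ = 1` cuts the cone in a paraboloid, parametrised by `stereo`, whose induced metric is the flat
metric of the plane. Hence `F = coneExt ∘ stereo` is an isometric immersion of the flat plane into
the null cone.

Differentiating the constant products of `F` and its first derivatives shows that the Hessian of `F`
is orthogonal to the surface and that its trace-free part is a multiple of `F`, with coefficients
`a` (`hessDiag`) and `c` (`hessOff`). The Codazzi equations say that `a - ic` is entire
(`differentiable_hopf`). By compactness of the sphere and homogeneity, the Hessian of `F` is bounded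
while the time component of `F` grows like `|z|²`, so `a - ic` tends to `0` and vanishes by
Liouville (`tendsto_hess`, `eq_quadratic`). Then `F` is a quadratic polynomial, which means that
`coneExt` is linear in `(x, |x|)`, and the metric relations make its coefficients a Lorentz frame
(`exists_lorentz_frame`).

Polar decomposition writes this frame as a rotation times a boost. Its spatial columns are
differences of values of `Φ` at antipodal points, so `w` and `R` are smooth in `r`. The form of `β`
comes from the Maurer-Cartan form of the family (`maurerCartan`): in the moving frame the
differential of `Φ` is `r dθ + β dr` plus a multiple of the null direction `(θ, 1)`, which the
metric does not see. Finally `β` combines a gradient and a rotated gradient of linear functions, and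
linear functions are the `ℓ = 1` harmonics. -/

/-! ### Linear algebra of `ℝ³` and of the Minkowski product -/

theorem inner_eq_sum (x y : E3) : inner ℝ x y = x 0 * y 0 + x 1 * y 1 + x 2 * y 2 := by
  simp [PiLp.inner_apply, Fin.sum_univ_three, mul_comm]

theorem norm_sq_eq_sum (x : E3) : ‖x‖ ^ 2 = x 0 ^ 2 + x 1 ^ 2 + x 2 ^ 2 := by
  rw [← real_inner_self_eq_norm_sq, inner_eq_sum]; ring

@[simp] theorem cross_zero (x y : E3) : cross x y 0 = x 1 * y 2 - x 2 * y 1 := by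
  simp [cross, cross_apply]

@[simp] theorem cross_one (x y : E3) : cross x y 1 = x 2 * y 0 - x 0 * y 2 := by
  simp [cross, cross_apply]

@[simp] theorem cross_two (x y : E3) : cross x y 2 = x 0 * y 1 - x 1 * y 0 := by
  simp [cross, cross_apply]

@[simp] theorem mv_apply (A : Matrix (Fin 3) (Fin 3) ℝ) (x : E3) (i : Fin 3) :
    mv A x i = A i 0 * x 0 + A i 1 * x 1 + A i 2 * x 2 := by
  simp [mv, Matrix.mulVec, dotProduct, Fin.sum_univ_three]

theorem ext3 {x y : E3} (h0 : x 0 = y 0) (h1 : x 1 = y 1) (h2 : x 2 = y 2) : x = y := by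
  ext i; fin_cases i <;> assumption

/-- A vector orthogonal to three linearly independent vectors of `ℝ³` vanishes. -/
theorem eq_zero_of_orthogonal {b x y z : E3} (h : inner ℝ x (cross y z) ≠ 0)
    (hx : inner ℝ b x = 0) (hy : inner ℝ b y = 0) (hz : inner ℝ b z = 0) : b = 0 := by
  simp only [inner_eq_sum, cross_zero, cross_one, cross_two] at h hx hy hz
  refine ext3 ?_ ?_ ?_ <;> refine (mul_eq_zero.mp ?_).resolve_left h <;> simp only []
  · linear_combination (y 1 * z 2 - y 2 * z 1) * hx + (z 1 * x 2 - z 2 * x 1) * hy +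
      (x 1 * y 2 - x 2 * y 1) * hz
  · linear_combination (y 2 * z 0 - y 0 * z 2) * hx + (z 2 * x 0 - z 0 * x 2) * hy +
      (x 2 * y 0 - x 0 * y 2) * hz
  · linear_combination (y 0 * z 1 - y 1 * z 0) * hx + (z 0 * x 1 - z 1 * x 0) * hy +
      (x 0 * y 1 - x 1 * y 0) * hz

theorem eta_comm (p q : Mink) : eta p q = eta q p := by
  simp [eta, real_inner_comm, mul_comm]

theorem eta_add_left (p p' q : Mink) : eta (p + p') q = eta p q + eta p' q := by
  simp [eta, inner_add_left]; ring

theorem eta_add_right (p q q' : Mink) : eta p (q + q') = eta p q + eta p q' := by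
  simp [eta, inner_add_right]; ring

theorem eta_sub_left (p p' q : Mink) : eta (p - p') q = eta p q - eta p' q := by
  simp [eta, inner_sub_left]; ring

theorem eta_sub_right (p q q' : Mink) : eta p (q - q') = eta p q - eta p q' := by
  simp [eta, inner_sub_right]; ring

theorem eta_smul_left (c : ℝ) (p q : Mink) : eta (c • p) q = c * eta p q := by
  simp [eta, inner_smul_left]; ring

theorem eta_smul_right (c : ℝ) (p q : Mink) : eta p (c • q) = c * eta p q := by
  simp [eta, inner_smul_right]; ring

/-- A vector orthogonal to a null vector `X` and to two directions completing it to a basis of the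
null hyperplane `X^⊥` is a multiple of `X`. -/
theorem eq_smul_of_orthogonal {A X Y Z : Mink} (h : inner ℝ X.1 (cross Y.1 Z.1) ≠ 0)
    (h2 : X.2 ≠ 0) (hXX : eta X X = 0) (hXY : eta X Y = 0) (hXZ : eta X Z = 0)
    (hX : eta A X = 0) (hY : eta A Y = 0) (hZ : eta A Z = 0) : A = (A.2 / X.2) • X := by
  -- Subtracting the multiple of `X` that removes the time component leaves a purely spatial vector,
  -- on which the products with `X`, `Y`, `Z` are Euclidean.
  have key : ∀ Q : Mink, eta X Q = 0 → eta A Q = 0 →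
      inner ℝ (A.1 - (A.2 / X.2) • X.1) Q.1 = 0 := by
    intro Q h1 h3
    simp only [eta] at h1 h3
    rw [inner_sub_left, real_inner_smul_left]
    field_simp
    linear_combination X.2 * h3 - A.2 * h1
  have := eq_zero_of_orthogonal h (key X hXX hX) (key Y hXY hY) (key Z hXZ hZ)
  refine Prod.ext (sub_eq_zero.mp this) ?_
  simp [h2]

/-! ### Directional derivatives on the plane -/

/-- The derivative of `F` in the constant direction `u`, as a function. -/
def dir {V : Type*} [NormedAddCommGroup V] [NormedSpace ℝ V] (u : ℂ) (F : ℂ → V) (z : ℂ) : V :=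
  fderiv ℝ F z u

section dir

variable {V : Type*} [NormedAddCommGroup V] [NormedSpace ℝ V]

theorem contDiff_dir {F : ℂ → V} (hF : ContDiff ℝ ∞ F) (u : ℂ) : ContDiff ℝ ∞ (dir u F) :=
  (hF.fderiv_right (m := ∞) (by simp)).clm_apply contDiff_const

theorem dir_comm {F : ℂ → V} (hF : ContDiff ℝ ∞ F) (u v : ℂ) :
    dir u (dir v F) = dir v (dir u F) := by
  funext z
  have hd : DifferentiableAt ℝ (fderiv ℝ F) z :=
    ((hF.fderiv_right (m := ∞) (by simp)).differentiable (by simp)) z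
  have key : ∀ a b : ℂ, dir a (dir b F) z = fderiv ℝ (fderiv ℝ F) z a b := by
    intro a b
    change fderiv ℝ (fun y => fderiv ℝ F y b) z a = _
    rw [fderiv_clm_apply hd (differentiableAt_const b)]
    simp
  rw [key, key]
  exact (hF.contDiffAt.isSymmSndFDerivAt (by simp; exact WithTop.coe_le_coe.mpr le_top)).eq u v

theorem contDiff_smul_fun {E : Type*} [NormedAddCommGroup E] [NormedSpace ℝ E] {c : E → ℝ}
    {F : E → V} (hc : ContDiff ℝ ∞ c) (hF : ContDiff ℝ ∞ F) :
    ContDiff ℝ ∞ (fun z => c z • F z) :=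
  hc.smul hF

theorem dir_add {F G : ℂ → V} (hF : ContDiff ℝ ∞ F) (hG : ContDiff ℝ ∞ G) (u z : ℂ) :
    dir u (fun z => F z + G z) z = dir u F z + dir u G z := by
  simp only [dir]
  rw [fderiv_fun_add (hF.differentiable (by simp) z) (hG.differentiable (by simp) z)]
  rfl

theorem dir_sub {F G : ℂ → V} (hF : ContDiff ℝ ∞ F) (hG : ContDiff ℝ ∞ G) (u z : ℂ) :
    dir u (fun z => F z - G z) z = dir u F z - dir u G z := by
  simp only [dir]
  rw [fderiv_fun_sub (hF.differentiable (by simp) z) (hG.differentiable (by simp) z)]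
  rfl

theorem dir_smul {c : ℂ → ℝ} {F : ℂ → V} (hc : ContDiff ℝ ∞ c) (hF : ContDiff ℝ ∞ F) (u z : ℂ) :
    dir u (fun z => c z • F z) z = dir u c z • F z + c z • dir u F z := by
  simp only [dir]
  rw [fderiv_fun_smul (hc.differentiable (by simp) z) (hF.differentiable (by simp) z)]
  simp [add_comm]

theorem dir_const (v : V) (u z : ℂ) : dir u (fun _ => v) z = 0 := by simp [dir]

theorem eq_of_dir_eq_zero {F : ℂ → V} (hF : ContDiff ℝ ∞ F) (hx : ∀ z, dir 1 F z = 0)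
    (hy : ∀ z, dir Complex.I F z = 0) (z : ℂ) : F z = F 0 := by
  refine is_const_of_fderiv_eq_zero (𝕜 := ℝ) (hF.differentiable (by simp)) (fun z => ?_) z 0
  ext u
  have hu : u = u.re • (1 : ℂ) + u.im • Complex.I := by simp
  rw [hu, map_add, map_smul, map_smul]
  have h1 := hx z
  have h2 := hy z
  simp only [dir] at h1 h2
  simp [h1, h2]

end dir

theorem contDiff_re : ContDiff ℝ ∞ (fun z : ℂ => z.re) := Complex.reCLM.contDiff

theorem contDiff_im : ContDiff ℝ ∞ (fun z : ℂ => z.im) := Complex.imCLM.contDiff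

theorem dir_re (u z : ℂ) : dir u (fun z : ℂ => z.re) z = u.re := by
  rw [dir, HasFDerivAt.fderiv (f := fun z : ℂ => z.re) (Complex.reCLM.hasFDerivAt (x := z))]; rfl

theorem dir_im (u z : ℂ) : dir u (fun z : ℂ => z.im) z = u.im := by
  rw [dir, HasFDerivAt.fderiv (f := fun z : ℂ => z.im) (Complex.imCLM.hasFDerivAt (x := z))]; rfl

theorem fderiv_snd_apply {V : Type*} [NormedAddCommGroup V] [NormedSpace ℝ V] {F : V → Mink}
    {z : V} (hF : DifferentiableAt ℝ F z) (u : V) :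
    fderiv ℝ (fun z => (F z).2) z u = (fderiv ℝ F z u).2 := by
  have := (hF.hasFDerivAt.snd).fderiv
  rw [this]; rfl

theorem fderiv_fst_apply {V : Type*} [NormedAddCommGroup V] [NormedSpace ℝ V] {F : V → Mink}
    {z : V} (hF : DifferentiableAt ℝ F z) (u : V) :
    fderiv ℝ (fun z => (F z).1) z u = (fderiv ℝ F z u).1 := by
  have := (hF.hasFDerivAt.fst).fderiv
  rw [this]; rfl

/-- The Leibniz rule for the Minkowski product. -/
theorem fderiv_eta_apply {V : Type*} [NormedAddCommGroup V] [NormedSpace ℝ V] {F G : V → Mink}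
    {z : V} (hF : DifferentiableAt ℝ F z) (hG : DifferentiableAt ℝ G z) (u : V) :
    fderiv ℝ (fun z => eta (F z) (G z)) z u
      = eta (fderiv ℝ F z u) (G z) + eta (F z) (fderiv ℝ G z u) := by
  simp only [eta]
  rw [fderiv_fun_sub (hF.fst.inner ℝ hG.fst) (hF.snd.fun_mul hG.snd),
    fderiv_fun_mul hF.snd hG.snd]
  simp only [sub_apply, add_apply, smul_apply, smul_eq_mul]
  rw [fderiv_inner_apply ℝ hF.fst hG.fst, fderiv_snd_apply hF, fderiv_snd_apply hG,
    fderiv_fst_apply hF, fderiv_fst_apply hG]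
  ring

theorem dir_eta {F G : ℂ → Mink} (hF : ContDiff ℝ ∞ F) (hG : ContDiff ℝ ∞ G) (u z : ℂ) :
    dir u (fun z => eta (F z) (G z)) z = eta (dir u F z) (G z) + eta (F z) (dir u G z) :=
  fderiv_eta_apply (hF.differentiable (by simp) z) (hG.differentiable (by simp) z) u

theorem eta_dir_of_const {F G : ℂ → Mink} (hF : ContDiff ℝ ∞ F) (hG : ContDiff ℝ ∞ G) {k : ℝ}
    (h : ∀ z, eta (F z) (G z) = k) (u z : ℂ) :
    eta (dir u F z) (G z) + eta (F z) (dir u G z) = 0 := by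
  rw [← dir_eta hF hG, funext h, dir_const]

/-! ### Rigidity of flat surfaces in the null cone -/

/-- An isometric immersion of the Euclidean plane into the null cone of Minkowski space, with
positive triple product. -/
structure IsFlatNullChart (F : ℂ → Mink) : Prop where
  smooth : ContDiff ℝ ∞ F
  null : ∀ z, eta (F z) (F z) = 0
  xx : ∀ z, eta (dir 1 F z) (dir 1 F z) = 1
  yy : ∀ z, eta (dir Complex.I F z) (dir Complex.I F z) = 1
  xy : ∀ z, eta (dir 1 F z) (dir Complex.I F z) = 0
  triple : ∀ z, 0 < inner ℝ (F z).1 (cross (dir 1 F z).1 (dir Complex.I F z).1)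
  time : ∀ z, (F z).2 ≠ 0

/-- Half the trace of the Hessian. -/
def meanHess (F : ℂ → Mink) (z : ℂ) : Mink :=
  (1 / 2 : ℝ) • (dir 1 (dir 1 F) z + dir Complex.I (dir Complex.I F) z)

/-- The diagonal coefficient of the trace-free Hessian relative to `F`. -/
def hessDiag (F : ℂ → Mink) (z : ℂ) : ℝ :=
  ((1 / 2 : ℝ) • (dir 1 (dir 1 F) z - dir Complex.I (dir Complex.I F) z)).2 / (F z).2

/-- The off-diagonal coefficient of the Hessian relative to `F`. -/
def hessOff (F : ℂ → Mink) (z : ℂ) : ℝ := (dir Complex.I (dir 1 F) z).2 / (F z).2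

namespace IsFlatNullChart

variable {F : ℂ → Mink} (h : IsFlatNullChart F)
include h

theorem contDiff_meanHess : ContDiff ℝ ∞ (meanHess F) :=
  contDiff_smul_fun contDiff_const ((contDiff_dir (contDiff_dir h.smooth _) _).add
    (contDiff_dir (contDiff_dir h.smooth _) _))

theorem contDiff_hessDiag : ContDiff ℝ ∞ (hessDiag F) :=
  ContDiff.div (contDiff_smul_fun contDiff_const ((contDiff_dir (contDiff_dir h.smooth _) _).sub
    (contDiff_dir (contDiff_dir h.smooth _) _))).snd h.smooth.snd h.time

theorem contDiff_hessOff : ContDiff ℝ ∞ (hessOff F) :=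
  ContDiff.div (contDiff_dir (contDiff_dir h.smooth _) _).snd h.smooth.snd h.time

theorem eta_self_dir (u z : ℂ) : eta (F z) (dir u F z) = 0 := by
  have := eta_dir_of_const h.smooth h.smooth h.null u z
  rw [eta_comm] at this
  linarith

/-- Obtained by differentiating the orthogonality of `F` to its own derivatives; the Hessian paired
with the position is minus the metric. -/
theorem eta_self_dir_dir (u v z : ℂ) :
    eta (dir u (dir v F) z) (F z) = - eta (dir u F z) (dir v F z) := by
  have := eta_dir_of_const h.smooth (contDiff_dir h.smooth v) (h.eta_self_dir v) u z
  rw [eta_comm (F z)] at this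
  linarith

theorem eta_hess (u z : ℂ) :
    eta (dir u (dir 1 F) z) (dir 1 F z) = 0 ∧
    eta (dir u (dir Complex.I F) z) (dir Complex.I F z) = 0 ∧
    eta (dir u (dir 1 F) z) (dir Complex.I F z) + eta (dir u (dir Complex.I F) z) (dir 1 F z) = 0
    := by
  have h1 := contDiff_dir h.smooth 1
  have h2 := contDiff_dir h.smooth Complex.I
  have hxx := eta_dir_of_const h1 h1 h.xx u z
  have hyy := eta_dir_of_const h2 h2 h.yy u z
  have hxy := eta_dir_of_const h1 h2 h.xy u z
  rw [eta_comm (dir 1 F z)] at hxx hxy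
  rw [eta_comm (dir Complex.I F z)] at hyy
  exact ⟨by linarith, by linarith, hxy⟩

/-- The Hessian of a flat null chart is orthogonal to the first derivatives. -/
theorem eta_hess_tangent (z : ℂ) :
    (eta (dir 1 (dir 1 F) z) (dir 1 F z) = 0 ∧
      eta (dir 1 (dir 1 F) z) (dir Complex.I F z) = 0) ∧
    (eta (dir Complex.I (dir 1 F) z) (dir 1 F z) = 0 ∧
      eta (dir Complex.I (dir 1 F) z) (dir Complex.I F z) = 0) ∧
    (eta (dir Complex.I (dir Complex.I F) z) (dir 1 F z) = 0 ∧
      eta (dir Complex.I (dir Complex.I F) z) (dir Complex.I F z) = 0) := by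
  obtain ⟨a1, a2, a3⟩ := h.eta_hess 1 z
  obtain ⟨b1, b2, b3⟩ := h.eta_hess Complex.I z
  -- Symmetry of the mixed partials closes the system, just as for the vanishing of the Christoffel
  -- symbols of a constant metric.
  rw [dir_comm h.smooth 1 Complex.I] at a2 a3
  exact ⟨⟨a1, by linarith⟩, ⟨b1, a2⟩, ⟨by linarith, b2⟩⟩

/-- `F`, `F_x`, `F_y` span the null hyperplane `F^⊥`, whose orthogonal complement is the line of `F`
itself. -/
theorem eq_smul {A : Mink} {z : ℂ} (h0 : eta A (F z) = 0) (h1 : eta A (dir 1 F z) = 0)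
    (h2 : eta A (dir Complex.I F z) = 0) : A = (A.2 / (F z).2) • F z :=
  eq_smul_of_orthogonal (h.triple z).ne' (h.time z) (h.null z) (h.eta_self_dir _ z)
    (h.eta_self_dir _ z) h0 h1 h2

theorem hess_diag (z : ℂ) :
    (1 / 2 : ℝ) • (dir 1 (dir 1 F) z - dir Complex.I (dir Complex.I F) z)
      = hessDiag F z • F z := by
  obtain ⟨⟨a1, a2⟩, -, c1, c2⟩ := h.eta_hess_tangent z
  refine h.eq_smul ?_ ?_ ?_
  · rw [eta_smul_left, eta_sub_left, h.eta_self_dir_dir, h.eta_self_dir_dir, h.xx, h.yy]; ring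
  · rw [eta_smul_left, eta_sub_left, a1, c1]; ring
  · rw [eta_smul_left, eta_sub_left, a2, c2]; ring

theorem hess_off : dir Complex.I (dir 1 F) = fun z => hessOff F z • F z := by
  funext z
  obtain ⟨-, ⟨b1, b2⟩, -⟩ := h.eta_hess_tangent z
  refine h.eq_smul ?_ b1 b2
  rw [h.eta_self_dir_dir, eta_comm, h.xy, neg_zero]

theorem hess_xx : dir 1 (dir 1 F) = fun z => meanHess F z + hessDiag F z • F z := by
  funext z
  rw [← h.hess_diag, meanHess]
  module

theorem hess_yy : dir Complex.I (dir Complex.I F) =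
    fun z => meanHess F z - hessDiag F z • F z := by
  funext z
  rw [← h.hess_diag, meanHess]
  module

theorem eta_meanHess (z : ℂ) : eta (meanHess F z) (F z) = -1 := by
  rw [meanHess, eta_smul_left, eta_add_left, h.eta_self_dir_dir, h.eta_self_dir_dir, h.xx, h.yy]
  ring

theorem eta_meanHess_one (z : ℂ) : eta (meanHess F z) (dir 1 F z) = 0 := by
  obtain ⟨⟨a1, a2⟩, -, c1, c2⟩ := h.eta_hess_tangent z
  rw [meanHess, eta_smul_left, eta_add_left, a1, c1]; ring

theorem eta_meanHess_I (z : ℂ) : eta (meanHess F z) (dir Complex.I F z) = 0 := by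
  obtain ⟨⟨a1, a2⟩, -, c1, c2⟩ := h.eta_hess_tangent z
  rw [meanHess, eta_smul_left, eta_add_left, a2, c2]; ring

/-- Integrability of third derivatives: `∂_y F_xx = ∂_x F_xy`, with `F_xx = H + aF` and `F_xy = cF`
inserted, where `H` is the mean Hessian. -/
theorem dir_I_meanHess (z : ℂ) : dir Complex.I (meanHess F) z =
    dir 1 (hessOff F) z • F z + hessOff F z • dir 1 F z
      - (dir Complex.I (hessDiag F) z • F z + hessDiag F z • dir Complex.I F z) := by
  have e : dir Complex.I (dir 1 (dir 1 F)) z = dir 1 (dir Complex.I (dir 1 F)) z :=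
    congrFun (dir_comm (contDiff_dir h.smooth 1) _ _) z
  rw [h.hess_xx, h.hess_off, dir_smul h.contDiff_hessOff h.smooth,
    dir_add h.contDiff_meanHess (contDiff_smul_fun h.contDiff_hessDiag h.smooth),
    dir_smul h.contDiff_hessDiag h.smooth] at e
  rw [← e]; abel

theorem dir_one_meanHess (z : ℂ) : dir 1 (meanHess F) z =
    dir 1 (hessDiag F) z • F z + hessDiag F z • dir 1 F z
      + (dir Complex.I (hessOff F) z • F z + hessOff F z • dir Complex.I F z) := by
  have e : dir 1 (dir Complex.I (dir Complex.I F)) z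
      = dir Complex.I (dir Complex.I (dir 1 F)) z := by
    rw [← congrFun (dir_comm (contDiff_dir h.smooth Complex.I) _ _) z,
      dir_comm h.smooth 1 Complex.I]
  rw [h.hess_yy, h.hess_off, dir_smul h.contDiff_hessOff h.smooth,
    dir_sub h.contDiff_meanHess (contDiff_smul_fun h.contDiff_hessDiag h.smooth),
    dir_smul h.contDiff_hessDiag h.smooth] at e
  rw [← e]; abel

/-- The mean Hessian is null: this is the Gauss equation of a flat surface. -/
theorem meanHess_null (z : ℂ) : eta (meanHess F z) (meanHess F z) = 0 := by
  -- Differentiate `η(H, F_y) = 0` along `y`. The terms in `hessDiag` cancel because `η(H, F) = -1`,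
  -- leaving `η(H, H) = 0`.
  have e := eta_dir_of_const h.contDiff_meanHess (contDiff_dir h.smooth Complex.I)
    h.eta_meanHess_I Complex.I z
  rw [h.dir_I_meanHess, h.hess_yy] at e
  simp only [eta_sub_left, eta_add_left, eta_smul_left, eta_sub_right, eta_smul_right] at e
  rw [h.eta_meanHess, h.eta_self_dir, h.xy, h.yy] at e
  linarith

/-- The Codazzi equations are the Cauchy-Riemann equations for the trace-free Hessian. -/
theorem codazzi (z : ℂ) : dir 1 (hessOff F) z = dir Complex.I (hessDiag F) z ∧
    dir 1 (hessDiag F) z = - dir Complex.I (hessOff F) z := by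
  -- Differentiating `η(H, H) = 0` isolates the `F`-component of `∂H`, since `H` is orthogonal to
  -- `F_x` and `F_y` but not to `F`.
  have e := eta_dir_of_const h.contDiff_meanHess h.contDiff_meanHess h.meanHess_null Complex.I z
  have e' := eta_dir_of_const h.contDiff_meanHess h.contDiff_meanHess h.meanHess_null 1 z
  rw [eta_comm (meanHess F z), h.dir_I_meanHess, eta_comm] at e
  rw [eta_comm (meanHess F z), h.dir_one_meanHess, eta_comm] at e'
  simp only [eta_sub_right, eta_add_right, eta_smul_right] at e e'
  rw [h.eta_meanHess, h.eta_meanHess_one, h.eta_meanHess_I] at e e'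
  constructor <;> linarith

/-- The analogue of the Hopf differential; the Codazzi equations are its Cauchy-Riemann equations.
-/
theorem differentiable_hopf :
    Differentiable ℂ (fun z => (hessDiag F z : ℂ) - Complex.I * (hessOff F z : ℂ)) := by
  intro z
  have ha : DifferentiableAt ℝ (hessDiag F) z := h.contDiff_hessDiag.differentiable (by simp) z
  have hc : DifferentiableAt ℝ (hessOff F) z := h.contDiff_hessOff.differentiable (by simp) z
  have ha' : HasFDerivAt (fun z => (hessDiag F z : ℂ))
      (Complex.ofRealCLM.comp (fderiv ℝ (hessDiag F) z)) z :=
    Complex.ofRealCLM.hasFDerivAt.comp z ha.hasFDerivAt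
  have hc' : HasFDerivAt (fun z => (hessOff F z : ℂ))
      (Complex.ofRealCLM.comp (fderiv ℝ (hessOff F) z)) z :=
    Complex.ofRealCLM.hasFDerivAt.comp z hc.hasFDerivAt
  have hq := ha'.sub (hc'.const_mul Complex.I)
  obtain ⟨c1, c2⟩ := h.codazzi z
  simp only [dir] at c1 c2
  refine differentiableAt_complex_iff_differentiableAt_real.mpr ⟨hq.differentiableAt, ?_⟩
  rw [HasFDerivAt.fderiv (f := fun z => (hessDiag F z : ℂ) - Complex.I * (hessOff F z : ℂ)) hq]
  simp [c1, c2]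
  linear_combination (fderiv ℝ (hessDiag F) z Complex.I : ℂ) * Complex.I_sq

open Filter Topology in
/-- A flat null chart with trace-free Hessian decaying at infinity is quadratic. -/
theorem eq_quadratic (ha : Tendsto (hessDiag F) (cocompact ℂ) (𝓝 0))
    (hc : Tendsto (hessOff F) (cocompact ℂ) (𝓝 0)) :
    ∃ N : Mink, eta N N = 0 ∧ eta N (F 0) = -1 ∧ eta N (dir 1 F 0) = 0 ∧
      eta N (dir Complex.I F 0) = 0 ∧ ∀ z : ℂ, F z = F 0 + z.re • dir 1 F 0
        + z.im • dir Complex.I F 0 + ((z.re ^ 2 + z.im ^ 2) / 2) • N := by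
  have hq : Tendsto (fun z => (hessDiag F z : ℂ) - Complex.I * (hessOff F z : ℂ))
      (cocompact ℂ) (𝓝 0) := by
    have := ((Complex.continuous_ofReal.tendsto 0).comp ha).sub
      (((Complex.continuous_ofReal.tendsto 0).comp hc).const_mul Complex.I)
    simpa using this
  have hzero : ∀ z, hessDiag F z = 0 ∧ hessOff F z = 0 := by
    intro z
    -- Liouville's theorem.
    have := h.differentiable_hopf.apply_eq_of_tendsto_cocompact z hq
    have h1 := congrArg Complex.re this
    have h2 := congrArg Complex.im this
    simp at h1 h2
    exact ⟨h1, h2⟩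
  have ha0 : hessDiag F = fun _ => 0 := funext fun z => (hzero z).1
  have hc0 : hessOff F = fun _ => 0 := funext fun z => (hzero z).2
  have hNx : ∀ z, dir 1 (meanHess F) z = 0 := fun z => by
    rw [h.dir_one_meanHess, ha0, hc0]; simp [dir_const]
  have hNy : ∀ z, dir Complex.I (meanHess F) z = 0 := fun z => by
    rw [h.dir_I_meanHess, ha0, hc0]; simp [dir_const]
  have hN := eq_of_dir_eq_zero h.contDiff_meanHess hNx hNy
  set N := meanHess F 0 with hNdef
  have hxx : ∀ z, dir 1 (dir 1 F) z = N := fun z => by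
    rw [h.hess_xx, ha0]; simp [hN z]
  have hyy : ∀ z, dir Complex.I (dir Complex.I F) z = N := fun z => by
    rw [h.hess_yy, ha0]; simp [hN z]
  have hxy : ∀ z, dir Complex.I (dir 1 F) z = 0 := fun z => by
    rw [h.hess_off, hc0]; simp
  have hyx : ∀ z, dir 1 (dir Complex.I F) z = 0 := fun z => by
    rw [dir_comm h.smooth]; exact hxy z
  have cre := contDiff_re
  have cim := contDiff_im
  have cN : ∀ v : Mink, ContDiff ℝ ∞ (fun _ : ℂ => v) := fun v => contDiff_const
  have hFx : ∀ z, dir 1 F z = dir 1 F 0 + z.re • N := by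
    intro z
    have := eq_of_dir_eq_zero (F := fun z => dir 1 F z - z.re • N)
      ((contDiff_dir h.smooth 1).sub (contDiff_smul_fun cre (cN N)))
      (fun z => by
        rw [dir_sub (contDiff_dir h.smooth 1) (contDiff_smul_fun cre (cN N)),
          dir_smul cre (cN N), dir_const, dir_re, hxx]; simp)
      (fun z => by
        rw [dir_sub (contDiff_dir h.smooth 1) (contDiff_smul_fun cre (cN N)),
          dir_smul cre (cN N), dir_const, dir_re, hxy]; simp) z
    simpa [sub_eq_iff_eq_add] using this
  have hFy : ∀ z, dir Complex.I F z = dir Complex.I F 0 + z.im • N := by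
    intro z
    have := eq_of_dir_eq_zero (F := fun z => dir Complex.I F z - z.im • N)
      ((contDiff_dir h.smooth Complex.I).sub (contDiff_smul_fun cim (cN N)))
      (fun z => by
        rw [dir_sub (contDiff_dir h.smooth Complex.I) (contDiff_smul_fun cim (cN N)),
          dir_smul cim (cN N), dir_const, dir_im, hyx]; simp)
      (fun z => by
        rw [dir_sub (contDiff_dir h.smooth Complex.I) (contDiff_smul_fun cim (cN N)),
          dir_smul cim (cN N), dir_const, dir_im, hyy]; simp) z
    simpa [sub_eq_iff_eq_add] using this
  refine ⟨N, h.meanHess_null 0, h.eta_meanHess 0, h.eta_meanHess_one 0, h.eta_meanHess_I 0, ?_⟩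
  intro z
  have cr2 : ContDiff ℝ ∞ (fun z : ℂ => z.re • (z.re • N)) :=
    contDiff_smul_fun cre (contDiff_smul_fun cre (cN N))
  have ci2 : ContDiff ℝ ∞ (fun z : ℂ => z.im • (z.im • N)) :=
    contDiff_smul_fun cim (contDiff_smul_fun cim (cN N))
  have c1 := contDiff_smul_fun cre (cN (dir 1 F 0))
  have c2 := contDiff_smul_fun cim (cN (dir Complex.I F 0))
  have c3 : ContDiff ℝ ∞ (fun z : ℂ => (1 / 2 : ℝ) • (z.re • (z.re • N) + z.im • (z.im • N))) :=
    contDiff_smul_fun contDiff_const (cr2.add ci2)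
  have hd : ∀ u z, dir u (fun z => F z - (z.re • dir 1 F 0 + z.im • dir Complex.I F 0 +
      (1 / 2 : ℝ) • (z.re • (z.re • N) + z.im • (z.im • N)))) z = dir u F z - (u.re • dir 1 F 0
        + u.im • dir Complex.I F 0 + (u.re * z.re) • N + (u.im * z.im) • N) := by
    intro u z
    rw [dir_sub h.smooth ((c1.add c2).add c3), dir_add (c1.add c2) c3, dir_add c1 c2,
      dir_smul cre (cN _), dir_smul cim (cN _), dir_smul contDiff_const (cr2.add ci2),
      dir_add cr2 ci2, dir_smul cre (contDiff_smul_fun cre (cN N)),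
      dir_smul cim (contDiff_smul_fun cim (cN N)),
      dir_smul cre (cN _), dir_smul cim (cN _)]
    simp only [dir_re, dir_im, dir_const]
    module
  have := eq_of_dir_eq_zero (h.smooth.sub ((c1.add c2).add c3))
    (fun z => by rw [hd, hFx]; simp) (fun z => by rw [hd, hFy]; simp) z
  simp only [Complex.zero_re, Complex.zero_im, zero_smul, smul_zero, add_zero, sub_zero] at this
  rw [sub_eq_iff_eq_add] at this
  rw [this]
  module

end IsFlatNullChart

/-! ### Homogeneous extensions of maps on the sphere -/

theorem S2.norm_eq_one (θ : S2) : ‖(θ : E3)‖ = 1 := by simp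

theorem S2.ne_zero (θ : S2) : (θ : E3) ≠ 0 := by
  intro h
  have := S2.norm_eq_one θ
  simp [h] at this

theorem S2.inner_self (θ : S2) : inner ℝ (θ : E3) θ = 1 := by
  rw [real_inner_self_eq_norm_sq, S2.norm_eq_one, one_pow]

/-- The direction of a nonzero vector. -/
def direction (x : E3) (hx : x ≠ 0) : S2 := ⟨‖x‖⁻¹ • x, by simp [norm_smul, hx]⟩

theorem norm_smul_direction (x : E3) (hx : x ≠ 0) : ‖x‖ • (direction x hx : E3) = x := by
  simp [direction, smul_smul, hx]

theorem radialExt_of_ne {V : Type*} [Zero V] (f : S2 → V) {x : E3} (hx : x ≠ 0) :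
    radialExt f x = f (direction x hx) := dif_pos hx

theorem radialExt_coe {V : Type*} [Zero V] (f : S2 → V) (θ : S2) : radialExt f θ = f θ := by
  rw [radialExt_of_ne f (S2.ne_zero θ)]
  congr 1
  ext1
  simp [direction]

theorem radialExt_smul {V : Type*} [Zero V] (f : S2 → V) {c : ℝ} (hc : 0 < c) (x : E3) :
    radialExt f (c • x) = radialExt f x := by
  by_cases hx : x = 0
  · simp [hx]
  · rw [radialExt_of_ne f hx, radialExt_of_ne f (smul_ne_zero hc.ne' hx)]
    congr 1
    ext1
    simp only [direction, norm_smul, smul_smul, Real.norm_eq_abs, abs_of_pos hc]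
    congr 1
    field_simp

theorem hasFDerivAt_norm {x : E3} (hx : x ≠ 0) :
    HasFDerivAt (fun x : E3 => ‖x‖) (‖x‖⁻¹ • innerSL ℝ x) x := by
  have hx' : ‖x‖ ≠ 0 := norm_ne_zero_iff.mpr hx
  have h1 : DifferentiableAt ℝ (fun x : E3 => ‖x‖) x :=
    (contDiffAt_norm ℝ hx (n := 1)).differentiableAt (by simp)
  have h2 : fderiv ℝ (fun x : E3 => ‖x‖) x = ‖x‖⁻¹ • innerSL ℝ x := by
    ext v
    have e1 : fderiv ℝ (fun x : E3 => ‖x‖ ^ 2) x v = 2 * inner ℝ x v := by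
      rw [(hasStrictFDerivAt_norm_sq x).hasFDerivAt.fderiv]; simp
    have e2 : fderiv ℝ (fun x : E3 => ‖x‖ ^ 2) x v
        = 2 * ‖x‖ * fderiv ℝ (fun x : E3 => ‖x‖) x v := by
      rw [(h1.hasFDerivAt.pow 2).fderiv]; simp
    simp only [smul_apply, innerSL_apply_apply, smul_eq_mul]
    field_simp
    linarith
  rw [← h2]
  exact h1.hasFDerivAt

section sphereCalculus

variable {V : Type*} [NormedAddCommGroup V] [NormedSpace ℝ V]

/-- The differential of a homogeneous function is homogeneous. -/
theorem fderiv_of_homogeneous {E : Type*} [NormedAddCommGroup E] [NormedSpace ℝ E] {G : E → V}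
    {c a : ℝ} (hc : c ≠ 0) (h : ∀ x, G (c • x) = a • G x) (x : E) :
    fderiv ℝ G (c • x) = (a / c) • fderiv ℝ G x := by
  have h1 := fderiv_comp_smul (f := G) (x := x) c
  rw [funext h] at h1
  have h2 : fderiv ℝ (fun x => a • G x) x = a • fderiv ℝ G x :=
    congrFun (fderiv_const_smul_field (𝕜 := ℝ) (f := G) a) x
  rw [h2] at h1
  rw [div_eq_inv_mul, mul_smul, h1, smul_smul, inv_mul_cancel₀ hc, one_smul]

theorem SphereSmooth.differentiableAt {f : S2 → V} (hf : SphereSmooth f) {x : E3} (hx : x ≠ 0) :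
    DifferentiableAt ℝ (radialExt f) x :=
  (hf.contDiffAt (isOpen_compl_singleton.mem_nhds hx)).differentiableAt (by simp)

theorem sphereDeriv_self {f : S2 → V} (hf : SphereSmooth f) (θ : S2) :
    sphereDeriv f θ θ = 0 := by
  have h1 : HasDerivAt (fun s : ℝ => radialExt f (s • (θ : E3))) (sphereDeriv f θ θ) 1 := by
    have hg : HasFDerivAt (radialExt f) (fderiv ℝ (radialExt f) θ) ((1 : ℝ) • (θ : E3)) := by
      rw [one_smul]; exact (hf.differentiableAt (S2.ne_zero θ)).hasFDerivAt
    have hs : HasDerivAt (fun s : ℝ => s • (θ : E3)) ((1 : ℝ) • (θ : E3)) 1 :=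
      (hasDerivAt_id (1 : ℝ)).smul_const _
    have := hg.comp_hasDerivAt 1 hs
    rwa [one_smul] at this
  have h2 : HasDerivAt (fun s : ℝ => radialExt f (s • (θ : E3))) 0 1 := by
    refine (hasDerivAt_const (1 : ℝ) (radialExt f θ)).congr_of_eventuallyEq ?_
    filter_upwards [lt_mem_nhds (zero_lt_one (α := ℝ))] with s hs
    exact radialExt_smul f hs _
  exact h1.unique h2

/-- The differential of a function on the sphere only sees the tangential component. -/
theorem sphereDeriv_tangentProj {f : S2 → V} (hf : SphereSmooth f) (θ : S2) (v : E3) :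
    sphereDeriv f θ (tangentProj θ v) = sphereDeriv f θ v := by
  have := sphereDeriv_self hf θ
  simp only [sphereDeriv] at this
  simp [sphereDeriv, tangentProj, this]

end sphereCalculus

theorem inner_tangentProj (θ : S2) (v : E3) : inner ℝ (θ : E3) (tangentProj θ v) = 0 := by
  simp [tangentProj, inner_sub_right, real_inner_smul_right]

theorem inner_tangentProj_tangentProj (θ : S2) (u v : E3) :
    inner ℝ (tangentProj θ u) (tangentProj θ v)
      = inner ℝ u v - inner ℝ (θ : E3) u * inner ℝ (θ : E3) v := by
  rw [tangentProj, inner_sub_left, real_inner_smul_left, inner_tangentProj, tangentProj,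
    inner_sub_right, real_inner_smul_right, real_inner_comm u (θ : E3)]
  ring

/-- The triple product `x · (y × z)`. -/
def triple (x y z : E3) : ℝ := inner ℝ x (cross y z)

theorem triple_eq (x y z : E3) : triple x y z = x 0 * (y 1 * z 2 - y 2 * z 1) +
    x 1 * (y 2 * z 0 - y 0 * z 2) + x 2 * (y 0 * z 1 - y 1 * z 0) := by
  simp [triple, inner_eq_sum]

/-- Radial components do not affect orientation, so a condition on tangent vectors extends to
arbitrary directions. -/
theorem triple_shear (x y z : E3) (k c d : ℝ) :
    triple (k • x) (c • x + y) (d • x + z) = k * triple x y z := by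
  simp [triple_eq]; ring

theorem triple_smul (x y z : E3) (k : ℝ) :
    triple x (k • y) (k • z) = k ^ 2 * triple x y z := by
  simp [triple_eq]; ring

/-- The extension of a map from the sphere to the cone to a map of `ℝ³ ∖ {0}` that is homogeneous
of degree one, normalised by the radius. -/
def coneExt (r : ℝ) (f : S2 → Cone) (x : E3) : Mink :=
  (r⁻¹ * ‖x‖) • radialExt (fun θ => (f θ : Mink)) x

theorem coneExt_coe (r : ℝ) (f : S2 → Cone) (θ : S2) :
    coneExt r f θ = r⁻¹ • (f θ : Mink) := by
  simp [coneExt, radialExt_coe]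

theorem coneExt_smul (r : ℝ) (f : S2 → Cone) {c : ℝ} (hc : 0 < c) (x : E3) :
    coneExt r f (c • x) = c • coneExt r f x := by
  simp only [coneExt, radialExt_smul _ hc, norm_smul, smul_smul, Real.norm_eq_abs, abs_of_pos hc]
  congr 1
  ring

theorem fderiv_coneExt_smul (r : ℝ) (f : S2 → Cone) {c : ℝ} (hc : 0 < c) (x : E3) :
    fderiv ℝ (coneExt r f) (c • x) = fderiv ℝ (coneExt r f) x := by
  rw [fderiv_of_homogeneous hc.ne' (coneExt_smul r f hc), div_self hc.ne', one_smul]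

/-- Homogeneity of degree `-1` of the second derivative will compensate the growth of the tangent
vectors of the paraboloid. -/
theorem fderiv_fderiv_coneExt_smul (r : ℝ) (f : S2 → Cone) {c : ℝ} (hc : 0 < c) (x : E3) :
    fderiv ℝ (fderiv ℝ (coneExt r f)) (c • x)
      = c⁻¹ • fderiv ℝ (fderiv ℝ (coneExt r f)) x := by
  rw [fderiv_of_homogeneous (a := 1) hc.ne'
    (fun x => by rw [fderiv_coneExt_smul r f hc, one_smul]), one_div]

theorem eta_cone (p : Cone) : eta (p : Mink) (p : Mink) = 0 := by
  rw [eta, p.2, real_inner_self_eq_norm_sq]; ring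

theorem coneExt_null (r : ℝ) (f : S2 → Cone) (x : E3) :
    eta (coneExt r f x) (coneExt r f x) = 0 := by
  by_cases hx : x = 0
  · simp [coneExt, hx, eta]
  · rw [coneExt, radialExt_of_ne _ hx, eta_smul_left, eta_smul_right, eta_cone]; ring

theorem exists_positive_tangent_frame (θ : S2) : ∃ u v : E3, inner ℝ (θ : E3) u = 0 ∧
    inner ℝ (θ : E3) v = 0 ∧ 0 < inner ℝ (θ : E3) (cross u v) := by
  have hθ := S2.inner_self θ
  rw [inner_eq_sum] at hθ
  obtain ⟨u, hu, hu0⟩ : ∃ u : E3, inner ℝ (θ : E3) u = 0 ∧ 0 < inner ℝ u u := by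
    simp only [inner_eq_sum]
    by_cases h : (θ : E3) 2 = 0
    · exact ⟨!₂[0, 0, 1], by simp [h], by simp⟩
    · refine ⟨!₂[0, (θ : E3) 2, -(θ : E3) 1], by simp; ring, ?_⟩
      have : 0 < (θ : E3) 2 ^ 2 := by positivity
      simp
      nlinarith [sq_nonneg ((θ : E3) 1)]
  refine ⟨u, cross θ u, hu, ?_, ?_⟩
  · simp [inner_eq_sum]; ring
  · convert hu0 using 1
    simp only [inner_eq_sum, cross_zero, cross_one, cross_two] at hu ⊢
    linear_combination (u 0 ^ 2 + u 1 ^ 2 + u 2 ^ 2) * hθ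
      - ((θ : E3) 0 * u 0 + (θ : E3) 1 * u 1 + (θ : E3) 2 * u 2) * hu

namespace IsQuasiSphere

variable {r : ℝ} {f : S2 → Cone} (h : IsQuasiSphere r f)
include h

/-- The vertex is excluded by the orientation condition: a triple product with the zero vector
cannot be positive. -/
theorem time_pos (θ : S2) : 0 < (f θ : Mink).2 := by
  obtain ⟨u, v, hu, hv, huv⟩ := exists_positive_tangent_frame θ
  have := h.orientation θ u v hu hv huv
  rw [(f θ).2, norm_pos_iff]
  intro h0
  rw [h0, inner_zero_left] at this
  exact this.false

theorem contDiffOn_coneExt : ContDiffOn ℝ ∞ (coneExt r f) {0}ᶜ := by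
  have h1 : ContDiffOn ℝ ∞ (fun x : E3 => r⁻¹ * ‖x‖) {0}ᶜ := fun x hx =>
    (contDiffAt_const.mul (contDiffAt_norm ℝ hx)).contDiffWithinAt
  exact h1.smul h.smooth

theorem differentiableAt_coneExt {x : E3} (hx : x ≠ 0) : DifferentiableAt ℝ (coneExt r f) x :=
  (h.contDiffOn_coneExt.contDiffAt (isOpen_compl_singleton.mem_nhds hx)).differentiableAt (by simp)

theorem fderiv_coneExt (θ : S2) (v : E3) :
    fderiv ℝ (coneExt r f) θ v = r⁻¹ • (inner ℝ (θ : E3) v • (f θ : Mink)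
      + sphereDeriv (fun θ => (f θ : Mink)) θ (tangentProj θ v)) := by
  have hn : HasFDerivAt (fun x : E3 => r⁻¹ * ‖x‖) (r⁻¹ • innerSL ℝ (θ : E3)) θ := by
    have h1 := (hasFDerivAt_norm (S2.ne_zero θ)).const_mul r⁻¹
    rwa [S2.norm_eq_one, inv_one, one_smul] at h1
  have hs := (h.smooth.differentiableAt (S2.ne_zero θ)).hasFDerivAt
  have := HasFDerivAt.fderiv (f := coneExt r f) (hn.smul hs)
  rw [this, sphereDeriv_tangentProj h.smooth]
  simp only [add_apply, smul_apply, ContinuousLinearMap.smulRight_apply, innerSL_apply_apply,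
    radialExt_coe, S2.norm_eq_one, sphereDeriv]
  simp only [smul_eq_mul, mul_one]
  module

theorem eta_sphereDeriv (θ : S2) (v : E3) :
    eta (f θ : Mink) (sphereDeriv (fun θ => (f θ : Mink)) θ v) = 0 := by
  have hd := h.smooth.differentiableAt (S2.ne_zero θ)
  have h1 := fderiv_eta_apply hd hd v
  have h2 : (fun x => eta (radialExt (fun θ => (f θ : Mink)) x)
      (radialExt (fun θ => (f θ : Mink)) x)) = fun _ => 0 := by
    funext x
    by_cases hx : x = 0
    · simp [radialExt, hx, eta]
    · rw [radialExt_of_ne _ hx, eta_cone]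
  rw [h2, radialExt_coe, eta_comm _ (f θ : Mink)] at h1
  simp only [fderiv_fun_const, Pi.zero_apply, zero_apply] at h1
  rw [sphereDeriv]
  linarith

/-- The degree-one extension preserves the degenerate metric of the cone. -/
theorem eta_fderiv_coneExt (hr : 0 < r) (θ : S2) (u v : E3) :
    eta (fderiv ℝ (coneExt r f) θ u) (fderiv ℝ (coneExt r f) θ v)
      = inner ℝ u v - inner ℝ (θ : E3) u * inner ℝ (θ : E3) v := by
  rw [h.fderiv_coneExt, h.fderiv_coneExt]
  simp only [eta_smul_left, eta_smul_right, eta_add_left, eta_add_right]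
  rw [h.metric _ _ _ (inner_tangentProj θ u) (inner_tangentProj θ v),
    inner_tangentProj_tangentProj, h.eta_sphereDeriv,
    eta_comm (sphereDeriv _ θ (tangentProj θ u)), h.eta_sphereDeriv, eta_cone]
  field_simp
  ring

theorem triple_fderiv_coneExt (hr : 0 < r) (θ : S2) {u v : E3}
    (huv : 0 < triple (θ : E3) u v) : 0 < triple (coneExt r f θ).1
      (fderiv ℝ (coneExt r f) θ u).1 (fderiv ℝ (coneExt r f) θ v).1 := by
  have h1 := h.orientation θ (tangentProj θ u) (tangentProj θ v) (inner_tangentProj θ u)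
    (inner_tangentProj θ v) (by
      change 0 < triple _ _ _
      have : triple (θ : E3) u v = triple (θ : E3) (tangentProj θ u) (tangentProj θ v) := by
        have := triple_shear (θ : E3) u v 1 (-inner ℝ (θ : E3) u) (-inner ℝ (θ : E3) v)
        rw [one_smul, one_mul] at this
        rw [← this, tangentProj, tangentProj]
        congr 1 <;> module
      rwa [← this])
  change 0 < triple _ _ _ at h1
  rw [coneExt_coe, h.fderiv_coneExt, h.fderiv_coneExt]
  simp only [Prod.smul_fst, Prod.fst_add]
  rw [triple_smul, triple_shear]
  positivity

end IsQuasiSphere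

/-! ### The flat paraboloid section of the cone -/

/-- The inverse stereographic projection from the south pole, rescaled by a conformal factor. -/
def stereo (z : ℂ) : E3 :=
  z.re • !₂[1, 0, 0] + z.im • !₂[0, 1, 0]
    + ((1 / 2 : ℝ) - (1 / 2 : ℝ) • (z.re • z.re + z.im • z.im)) • !₂[0, 0, 1]

theorem contDiff_normSq : ContDiff ℝ ∞ (fun z : ℂ => z.re • z.re + z.im • z.im) :=
  (contDiff_smul_fun contDiff_re contDiff_re).add (contDiff_smul_fun contDiff_im contDiff_im)

theorem contDiff_stereo : ContDiff ℝ ∞ stereo :=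
  ((contDiff_smul_fun contDiff_re contDiff_const).add
    (contDiff_smul_fun contDiff_im contDiff_const)).add (contDiff_smul_fun (contDiff_const.sub
      (contDiff_smul_fun contDiff_const contDiff_normSq)) contDiff_const)

theorem dir_stereo (u : ℂ) : dir u stereo = fun z => u.re • !₂[1, 0, 0] + u.im • !₂[0, 1, 0]
    - (u.re • z.re + u.im • z.im) • (!₂[0, 0, 1] : E3) := by
  funext z
  have c0 : ∀ v : E3, ContDiff ℝ ∞ (fun _ : ℂ => v) := fun v => contDiff_const
  have c1 : ∀ v : ℝ, ContDiff ℝ ∞ (fun _ : ℂ => v) := fun v => contDiff_const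
  have c2 := contDiff_smul_fun (c1 (1 / 2)) contDiff_normSq
  have c3 := (c1 (1 / 2)).sub c2
  unfold stereo
  rw [dir_add ((contDiff_smul_fun contDiff_re (c0 _)).add (contDiff_smul_fun contDiff_im (c0 _)))
    (contDiff_smul_fun c3 (c0 _)), dir_add (contDiff_smul_fun contDiff_re (c0 _))
    (contDiff_smul_fun contDiff_im (c0 _)), dir_smul contDiff_re (c0 _),
    dir_smul contDiff_im (c0 _), dir_smul c3 (c0 _), dir_sub (c1 _) c2,
    dir_smul (c1 _) contDiff_normSq, dir_add (contDiff_smul_fun contDiff_re contDiff_re)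
      (contDiff_smul_fun contDiff_im contDiff_im), dir_smul contDiff_re contDiff_re,
    dir_smul contDiff_im contDiff_im]
  simp only [dir_const, dir_re, dir_im, smul_eq_mul]
  module

theorem dir_dir_stereo (u v z : ℂ) :
    dir v (dir u stereo) z = -(u.re * v.re + u.im * v.im) • (!₂[0, 0, 1] : E3) := by
  have c0 : ∀ v : E3, ContDiff ℝ ∞ (fun _ : ℂ => v) := fun v => contDiff_const
  have c1 : ∀ v : ℝ, ContDiff ℝ ∞ (fun _ : ℂ => v) := fun v => contDiff_const
  have c2 := contDiff_smul_fun (c1 u.re) contDiff_re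
  have c3 := contDiff_smul_fun (c1 u.im) contDiff_im
  rw [dir_stereo, dir_sub (c0 _) (contDiff_smul_fun (c2.add c3) (c0 _)), dir_const,
    dir_smul (c2.add c3) (c0 _), dir_add c2 c3, dir_smul (c1 _) contDiff_re,
    dir_smul (c1 _) contDiff_im]
  simp only [dir_const, dir_re, dir_im, smul_eq_mul]
  module

@[simp] theorem stereo_zero_coord (z : ℂ) : stereo z 0 = z.re := by simp [stereo]

@[simp] theorem stereo_one_coord (z : ℂ) : stereo z 1 = z.im := by simp [stereo]

@[simp] theorem stereo_two_coord (z : ℂ) :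
    stereo z 2 = (1 - z.re ^ 2 - z.im ^ 2) / 2 := by simp [stereo]; ring

/-- The length of `stereo z`. -/
def stereoNorm (z : ℂ) : ℝ := (1 + ‖z‖ ^ 2) / 2

theorem stereoNorm_eq (z : ℂ) : stereoNorm z = (1 + z.re ^ 2 + z.im ^ 2) / 2 := by
  rw [stereoNorm, Complex.sq_norm, Complex.normSq_apply]; ring

theorem stereoNorm_pos (z : ℂ) : 0 < stereoNorm z := by
  unfold stereoNorm; positivity

theorem norm_stereo (z : ℂ) : ‖stereo z‖ = stereoNorm z := by
  rw [← sq_eq_sq₀ (norm_nonneg _) (stereoNorm_pos z).le, norm_sq_eq_sum, stereoNorm_eq]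
  simp
  ring

theorem stereo_ne_zero (z : ℂ) : stereo z ≠ 0 := by
  rw [← norm_ne_zero_iff, norm_stereo]
  exact (stereoNorm_pos z).ne'

/-- Tangent vectors grow only like the square root of the length of the position, because `|∂_u
stereo|² = 1 + (u · z)²` for unit `u`. -/
theorem norm_dir_stereo_le {u : ℂ} (hu : ‖u‖ = 1) (z : ℂ) :
    ‖dir u stereo z‖ ^ 2 ≤ 2 * stereoNorm z := by
  have h : u.re ^ 2 + u.im ^ 2 = 1 := by
    have := Complex.sq_norm u
    rw [hu, Complex.normSq_apply] at this
    linarith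
  rw [norm_sq_eq_sum, dir_stereo, stereoNorm_eq]
  simp
  nlinarith [sq_nonneg (u.re * z.im - u.im * z.re), sq_nonneg (u.re * z.re + u.im * z.im),
    congrArg (· * (z.re ^ 2 + z.im ^ 2)) h]

theorem norm_dir_dir_stereo_le {u v : ℂ} (hu : ‖u‖ = 1) (hv : ‖v‖ = 1) (z : ℂ) :
    ‖dir v (dir u stereo) z‖ ≤ 2 := by
  rw [dir_dir_stereo, norm_smul]
  have h3 : ‖(!₂[0, 0, 1] : E3)‖ = 1 := by
    rw [← sq_eq_sq₀ (norm_nonneg _) zero_le_one, norm_sq_eq_sum]; simp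
  have h1 := Complex.abs_re_le_norm u
  have h2 := Complex.abs_im_le_norm u
  have h4 := Complex.abs_re_le_norm v
  have h5 := Complex.abs_im_le_norm v
  rw [h3, mul_one, norm_neg, Real.norm_eq_abs]
  rw [hu] at h1 h2
  rw [hv] at h4 h5
  refine (abs_add_le _ _).trans ?_
  rw [abs_mul, abs_mul]
  nlinarith [abs_nonneg u.re, abs_nonneg u.im, abs_nonneg v.re, abs_nonneg v.im]

/-! ### Quasi-spheres are Lorentz images of the standard sphere -/

namespace IsQuasiSphere

variable {r : ℝ} {f : S2 → Cone} (h : IsQuasiSphere r f)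
include h

theorem dir_chart (u z : ℂ) : dir u (fun z => coneExt r f (stereo z)) z
    = fderiv ℝ (coneExt r f) (stereo z) (dir u stereo z) := by
  have h1 := (h.differentiableAt_coneExt (stereo_ne_zero z)).hasFDerivAt
  have h2 := (contDiff_stereo.differentiable (by simp) z).hasFDerivAt
  have := HasFDerivAt.fderiv (f := fun z => coneExt r f (stereo z)) (h1.comp z h2)
  rw [dir, this]
  rfl

theorem dir_dir_chart (u v z : ℂ) : dir v (dir u (fun z => coneExt r f (stereo z))) z
    = fderiv ℝ (fderiv ℝ (coneExt r f)) (stereo z) (dir v stereo z) (dir u stereo z)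
      + fderiv ℝ (coneExt r f) (stereo z) (dir v (dir u stereo) z) := by
  rw [funext (h.dir_chart u)]
  have h1 : HasFDerivAt (fderiv ℝ (coneExt r f)) (fderiv ℝ (fderiv ℝ (coneExt r f)) (stereo z))
      (stereo z) := by
    have := h.contDiffOn_coneExt.fderiv_of_isOpen (m := ∞) isOpen_compl_singleton (by simp)
    exact ((this.contDiffAt (isOpen_compl_singleton.mem_nhds (stereo_ne_zero z))).differentiableAt
      (by simp)).hasFDerivAt
  have h2 := (contDiff_stereo.differentiable (by simp) z).hasFDerivAt
  have h3 := ((contDiff_dir contDiff_stereo u).differentiable (by simp) z).hasFDerivAt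
  have := HasFDerivAt.fderiv (f := fun z => fderiv ℝ (coneExt r f) (stereo z) (dir u stereo z))
    ((h1.comp z h2).clm_apply h3)
  rw [dir, this]
  simp [dir, add_comm]

/-- Take the minimum over the compact unit sphere, where the time is positive, and extend by
homogeneity. -/
theorem exists_time_lower_bound (hr : 0 < r) :
    ∃ c : ℝ, 0 < c ∧ ∀ x : E3, x ≠ 0 → c * ‖x‖ ≤ (coneExt r f x).2 := by
  have hcont : ContinuousOn (fun x => (coneExt r f x).2) (Metric.sphere (0 : E3) 1) :=
    continuous_snd.comp_continuousOn (h.contDiffOn_coneExt.continuousOn.mono fun x hx =>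
      S2.ne_zero ⟨x, hx⟩)
  obtain ⟨x₀, hx₀, hmin⟩ := (isCompact_sphere (0 : E3) 1).exists_isMinOn
    ((NormedSpace.sphere_nonempty).mpr zero_le_one) hcont
  refine ⟨(coneExt r f x₀).2, ?_, fun x hx => ?_⟩
  · have := coneExt_coe r f ⟨x₀, hx₀⟩
    simp only at this
    rw [this, Prod.smul_snd, smul_eq_mul]
    have := h.time_pos ⟨x₀, hx₀⟩
    positivity
  · have h1 := hmin (direction x hx).2
    simp only [Set.mem_ofPred_eq] at h1
    have h2 := coneExt_smul r f (norm_pos_iff.mpr hx) (direction x hx)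
    rw [norm_smul_direction] at h2
    rw [h2, Prod.smul_snd, smul_eq_mul, mul_comm]
    exact mul_le_mul_of_nonneg_left h1 (norm_nonneg x)

theorem exists_chart_hessian_bound : ∃ C : ℝ, ∀ u v z : ℂ, ‖u‖ = 1 → ‖v‖ = 1 →
    ‖dir v (dir u (fun z => coneExt r f (stereo z))) z‖ ≤ C := by
  have hs : Metric.sphere (0 : E3) 1 ⊆ {0}ᶜ := fun x hx => S2.ne_zero ⟨x, hx⟩
  have s1 := h.contDiffOn_coneExt.fderiv_of_isOpen (m := ∞) isOpen_compl_singleton (by simp)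
  have s2 := s1.fderiv_of_isOpen (m := ∞) isOpen_compl_singleton (by simp)
  obtain ⟨C1, hC1⟩ := (isCompact_sphere (0 : E3) 1).exists_bound_of_continuousOn
    (s1.continuousOn.mono hs)
  obtain ⟨C2, hC2⟩ := (isCompact_sphere (0 : E3) 1).exists_bound_of_continuousOn
    (s2.continuousOn.mono hs)
  -- `C1` and `C2` bound the first two derivatives on the unit sphere. At length `n` the second
  -- derivative is at most `C2 / n` and acts on two tangent vectors with product of lengths at most
  -- `2n`; the first is at most `C1` and acts on a vector of length at most `2`.
  refine ⟨C2 * 2 + C1 * 2, fun u v z hu hv => ?_⟩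
  set n := stereoNorm z with hn
  have hnpos : 0 < n := stereoNorm_pos z
  set θ := direction (stereo z) (stereo_ne_zero z)
  have hθ : n • (θ : E3) = stereo z := by
    rw [hn, ← norm_stereo]; exact norm_smul_direction _ _
  have b1 := hC1 θ θ.2
  have b2 := hC2 θ θ.2
  have e1 := fderiv_coneExt_smul r f hnpos (θ : E3)
  have e2 := fderiv_fderiv_coneExt_smul r f hnpos (θ : E3)
  rw [hθ] at e1 e2
  rw [h.dir_dir_chart, e1, e2]
  have q : ‖dir v stereo z‖ * ‖dir u stereo z‖ ≤ 2 * n := by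
    nlinarith [norm_dir_stereo_le hu z, norm_dir_stereo_le hv z,
      sq_nonneg (‖dir v stereo z‖ - ‖dir u stereo z‖)]
  refine (norm_add_le _ _).trans (add_le_add ?_ ?_)
  · rw [smul_apply, smul_apply, norm_smul, norm_inv, Real.norm_eq_abs, abs_of_pos hnpos,
      inv_mul_le_iff₀ hnpos]
    refine (ContinuousLinearMap.le_opNorm₂ _ _ _).trans ?_
    rw [mul_assoc]
    refine (mul_le_mul b2 q (by positivity) ((norm_nonneg _).trans b2)).trans_eq (by ring)
  · refine (ContinuousLinearMap.le_opNorm _ _).trans ?_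
    exact mul_le_mul b1 (norm_dir_dir_stereo_le hu hv z) (norm_nonneg _) ((norm_nonneg _).trans b1)

/-- `coneExt` preserves the degenerate metric, so it suffices that the paraboloid is flat: removing
the radial part of `∂_u stereo` leaves exactly the Euclidean metric of the plane. -/
theorem isFlatNullChart (hr : 0 < r) : IsFlatNullChart (fun z => coneExt r f (stereo z)) := by
  have key : ∀ u v z : ℂ, eta (dir u (fun z => coneExt r f (stereo z)) z)
      (dir v (fun z => coneExt r f (stereo z)) z) = inner ℝ (dir u stereo z) (dir v stereo z)
        - inner ℝ (stereo z) (dir u stereo z) * inner ℝ (stereo z) (dir v stereo z)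
          / stereoNorm z ^ 2 := by
    intro u v z
    have hn := stereoNorm_pos z
    set θ := direction (stereo z) (stereo_ne_zero z)
    have hθ : stereoNorm z • (θ : E3) = stereo z := by
      rw [← norm_stereo]; exact norm_smul_direction _ _
    have e1 := fderiv_coneExt_smul r f hn (θ : E3)
    rw [hθ] at e1
    rw [h.dir_chart, h.dir_chart, e1, h.eta_fderiv_coneExt hr]
    have hi : ∀ w : E3, inner ℝ (stereo z) w = stereoNorm z * inner ℝ (θ : E3) w := fun w => by
      rw [← real_inner_smul_left, hθ]
    rw [hi, hi]
    field_simp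
  have hre : ∀ z : ℂ, 1 + z.re ^ 2 + z.im ^ 2 ≠ 0 := fun z => by positivity
  refine ⟨?_, fun z => coneExt_null _ _ _, fun z => ?_, fun z => ?_, fun z => ?_, fun z => ?_,
    fun z => ?_⟩
  · exact h.contDiffOn_coneExt.comp_contDiff contDiff_stereo stereo_ne_zero
  · have := hre z
    rw [key, inner_eq_sum, inner_eq_sum, stereoNorm_eq, dir_stereo]
    simp
    field_simp
    ring
  · have := hre z
    rw [key, inner_eq_sum, inner_eq_sum, stereoNorm_eq, dir_stereo]
    simp
    field_simp
    ring
  · have := hre z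
    rw [key, inner_eq_sum, inner_eq_sum, inner_eq_sum, stereoNorm_eq, dir_stereo, dir_stereo]
    simp
    field_simp
    ring
  · have hn := stereoNorm_pos z
    set θ := direction (stereo z) (stereo_ne_zero z)
    have hθ : stereoNorm z • (θ : E3) = stereo z := by
      rw [← norm_stereo]; exact norm_smul_direction _ _
    have e0 := coneExt_smul r f hn (θ : E3)
    have e1 := fderiv_coneExt_smul r f hn (θ : E3)
    rw [hθ] at e0 e1
    rw [h.dir_chart, h.dir_chart, e0, e1, Prod.smul_fst, real_inner_smul_left]
    refine mul_pos hn (h.triple_fderiv_coneExt hr θ ?_)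
    refine (mul_pos_iff_of_pos_left hn).mp ?_
    rw [triple, ← real_inner_smul_left, hθ]
    change 0 < triple _ _ _
    rw [triple_eq, dir_stereo, dir_stereo]
    simp
    nlinarith [sq_nonneg z.re, sq_nonneg z.im]
  · obtain ⟨c, hc, hb⟩ := h.exists_time_lower_bound hr
    have := hb _ (stereo_ne_zero z)
    have h2 := norm_pos_iff.mpr (stereo_ne_zero z)
    exact ((mul_pos hc h2).trans_le this).ne'

open Filter Topology in
-- A bounded Hessian is divided by a time component of size at least a constant times `1 + |z|²`.
theorem tendsto_hess (hr : 0 < r) :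
    Tendsto (hessDiag (fun z => coneExt r f (stereo z))) (cocompact ℂ) (𝓝 0) ∧
    Tendsto (hessOff (fun z => coneExt r f (stereo z))) (cocompact ℂ) (𝓝 0) := by
  obtain ⟨c, hc, hb⟩ := h.exists_time_lower_bound hr
  obtain ⟨C, hC⟩ := h.exists_chart_hessian_bound
  have lim : Tendsto (fun z : ℂ => C / (c * stereoNorm z)) (cocompact ℂ) (𝓝 0) := by
    refine tendsto_const_nhds.div_atTop (Tendsto.const_mul_atTop hc ?_)
    refine Tendsto.atTop_div_const two_pos (tendsto_atTop_add_const_left _ _ ?_)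
    exact (tendsto_pow_atTop two_ne_zero).comp tendsto_norm_cocompact_atTop
  have bound : ∀ (p : Mink) (z : ℂ), ‖p‖ ≤ C →
      ‖p.2 / (coneExt r f (stereo z)).2‖ ≤ C / (c * stereoNorm z) := by
    intro p z hp
    have h1 := hb _ (stereo_ne_zero z)
    have h2 := mul_pos hc (stereoNorm_pos z)
    rw [norm_stereo] at h1
    rw [norm_div, Real.norm_eq_abs (coneExt r f (stereo z)).2, abs_of_pos (h2.trans_le h1)]
    exact div_le_div₀ ((norm_nonneg _).trans hp) ((norm_snd_le p).trans hp) h2 h1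
  constructor
  · refine squeeze_zero_norm (fun z => bound _ z ?_) lim
    rw [norm_smul]
    have a1 := hC 1 1 z (by simp) (by simp)
    have a2 := hC Complex.I Complex.I z (by simp) (by simp)
    have a3 := norm_sub_le (dir 1 (dir 1 (fun z => coneExt r f (stereo z))) z)
      (dir Complex.I (dir Complex.I (fun z => coneExt r f (stereo z))) z)
    norm_num
    linarith
  · exact squeeze_zero_norm (fun z => bound _ z (hC 1 Complex.I z (by simp) (by simp))) lim

open Filter Topology in
/-- A quasi-sphere is the image of the standard sphere under a proper Lorentz transformation: the
vectors `T, X₀, X₁, X₂` are its columns. -/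
theorem exists_lorentz_frame (hr : 0 < r) : ∃ T X₀ X₁ X₂ : Mink,
    (∀ θ : S2, (f θ : Mink) = r • (T + (θ : E3) 0 • X₀ + (θ : E3) 1 • X₁ + (θ : E3) 2 • X₂)) ∧
    eta T T = -1 ∧ eta T X₀ = 0 ∧ eta T X₁ = 0 ∧ eta T X₂ = 0 ∧
    eta X₀ X₀ = 1 ∧ eta X₁ X₁ = 1 ∧ eta X₂ X₂ = 1 ∧
    eta X₀ X₁ = 0 ∧ eta X₀ X₂ = 0 ∧ eta X₁ X₂ = 0 ∧
    0 < triple (T.1 + X₂.1) X₀.1 X₁.1 := by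
  have hF := h.isFlatNullChart hr
  obtain ⟨N, hNN, hN0, hNx, hNy, hq⟩ := hF.eq_quadratic (h.tendsto_hess hr).1 (h.tendsto_hess hr).2
  set F : ℂ → Mink := fun z => coneExt r f (stereo z) with hFdef
  set F0 := F 0 with hF0
  set Fx := dir 1 F 0
  set Fy := dir Complex.I F 0
  have hN0 : eta N F0 = -1 := hN0
  have hq : ∀ z : ℂ, F z = F0 + z.re • Fx + z.im • Fy + ((z.re ^ 2 + z.im ^ 2) / 2) • N := hq
  -- Every ray except the negative `x₂`-axis meets the paraboloid: `x = s • stereo z` with `s = ‖x‖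
  -- + x₂`, and homogeneity turns the quadratic formula for `F` into one linear in `(x, ‖x‖)`.
  have generic : ∀ x : E3, ‖x‖ + x 2 ≠ 0 → x ≠ 0 → coneExt r f x
      = ‖x‖ • (F0 + (1 / 2 : ℝ) • N) + x 0 • Fx + x 1 • Fy + x 2 • (F0 - (1 / 2 : ℝ) • N) := by
    intro x hx hx0
    have hle : |x 2| ≤ ‖x‖ := by
      refine abs_le_of_sq_le_sq ?_ (norm_nonneg x)
      rw [norm_sq_eq_sum]
      nlinarith [sq_nonneg (x 0), sq_nonneg (x 1)]
    have hs : 0 < ‖x‖ + x 2 := lt_of_le_of_ne (by linarith [neg_le_of_abs_le hle]) hx.symm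
    set s := ‖x‖ + x 2 with hsdef
    set z : ℂ := ⟨x 0 / s, x 1 / s⟩ with hz
    have hn := norm_sq_eq_sum x
    have hzz : z.re ^ 2 + z.im ^ 2 = (‖x‖ - x 2) / s := by
      simp only [hz]
      field_simp
      rw [hsdef]
      linear_combination -hn
    have hxz : x = s • stereo z := by
      refine ext3 ?_ ?_ ?_
      · simp [hz]; field_simp
      · simp [hz]; field_simp
      · have : stereo z 2 = (1 - (z.re ^ 2 + z.im ^ 2)) / 2 := by rw [stereo_two_coord]; ring
        simp only [PiLp.smul_apply, smul_eq_mul]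
        rw [this, hzz]
        field_simp
        rw [hsdef]
        ring
    have e : coneExt r f x = s • F z := by
      rw [hFdef]
      simp only
      rw [← coneExt_smul r f hs, ← hxz]
    rw [e, hq z, hzz]
    simp only [smul_add, smul_smul]
    have e0 : s * z.re = x 0 := by simp only [hz]; field_simp
    have e1 : s * z.im = x 1 := by simp only [hz]; field_simp
    have e2 : s * ((‖x‖ - x 2) / s / 2) = (‖x‖ - x 2) / 2 := by field_simp
    rw [e0, e1, e2, hsdef]
    module
  have all : ∀ x : E3, x ≠ 0 → coneExt r f x
      = ‖x‖ • (F0 + (1 / 2 : ℝ) • N) + x 0 • Fx + x 1 • Fy + x 2 • (F0 - (1 / 2 : ℝ) • N) := by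
    intro x hx0
    by_cases hx : ‖x‖ + x 2 = 0
    swap
    · exact generic x hx hx0
    -- The missing ray is reached by continuity, approaching it along the first coordinate
    -- direction.
    have hγ : Continuous (fun t : ℝ => x + t • (!₂[1, 0, 0] : E3)) := by fun_prop
    have hγ0 : Tendsto (fun t : ℝ => x + t • (!₂[1, 0, 0] : E3)) (𝓝[≠] 0) (𝓝 x) := by
      have := hγ.tendsto 0
      simp only [zero_smul, add_zero] at this
      exact this.mono_left nhdsWithin_le_nhds
    have hx00 : x 0 = 0 := by
      have hn := norm_sq_eq_sum x
      have : ‖x‖ = - x 2 := by linarith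
      rw [this] at hn
      have : x 0 ^ 2 = 0 := by nlinarith [sq_nonneg (x 0), sq_nonneg (x 1)]
      exact pow_eq_zero_iff two_ne_zero |>.mp this
    have lhs : Tendsto (fun t : ℝ => coneExt r f (x + t • (!₂[1, 0, 0] : E3))) (𝓝[≠] 0)
        (𝓝 (coneExt r f x)) :=
      (h.differentiableAt_coneExt hx0).continuousAt.tendsto.comp hγ0
    have rhs : Tendsto (fun x : E3 => ‖x‖ • (F0 + (1 / 2 : ℝ) • N) + x 0 • Fx + x 1 • Fy
        + x 2 • (F0 - (1 / 2 : ℝ) • N)) (𝓝 x) (𝓝 (‖x‖ • (F0 + (1 / 2 : ℝ) • N) + x 0 • Fx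
          + x 1 • Fy + x 2 • (F0 - (1 / 2 : ℝ) • N))) := by
      refine Continuous.tendsto ?_ x
      fun_prop
    refine tendsto_nhds_unique_of_eventuallyEq lhs (rhs.comp hγ0) ?_
    filter_upwards [self_mem_nhdsWithin] with t ht
    have ht0 : t ≠ 0 := ht
    have hne : (x + t • (!₂[1, 0, 0] : E3)) 0 ≠ 0 := by simpa [hx00] using ht0
    refine generic _ (fun h0 => hne ?_) (fun h0 => hne (by rw [h0]; simp))
    have hn := norm_sq_eq_sum (x + t • (!₂[1, 0, 0] : E3))
    set y := x + t • (!₂[1, 0, 0] : E3)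
    have : ‖y‖ = - y 2 := by linarith
    rw [this] at hn
    have : y 0 ^ 2 = 0 := by nlinarith [sq_nonneg (y 0), sq_nonneg (y 1)]
    exact pow_eq_zero_iff two_ne_zero |>.mp this
  have n0 : eta F0 F0 = 0 := hF.null 0
  have nx : eta F0 Fx = 0 := hF.eta_self_dir 1 0
  have ny : eta F0 Fy = 0 := hF.eta_self_dir Complex.I 0
  have xN : eta Fx N = 0 := by rw [eta_comm]; exact hNx
  have yN : eta Fy N = 0 := by rw [eta_comm]; exact hNy
  have x0 : eta Fx F0 = 0 := by rw [eta_comm]; exact nx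
  have y0 : eta Fy F0 = 0 := by rw [eta_comm]; exact ny
  have oN : eta F0 N = -1 := by rw [eta_comm]; exact hN0
  -- `F0` and `N` are null with `η(N, F0) = -1`, so their combinations `F0 ± N/2` are an orthogonal
  -- pair of a unit timelike and a unit spacelike vector.
  refine ⟨F0 + (1 / 2 : ℝ) • N, Fx, Fy, F0 - (1 / 2 : ℝ) • N, fun θ => ?_, ?_, ?_, ?_, ?_,
    hF.xx 0, hF.yy 0, ?_, hF.xy 0, ?_, ?_, ?_⟩
  · have h1 := all θ (S2.ne_zero θ)
    rw [coneExt_coe, S2.norm_eq_one, one_smul] at h1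
    rw [← h1, smul_inv_smul₀ hr.ne']
  · simp only [eta_add_left, eta_add_right, eta_smul_left, eta_smul_right, n0, oN, hN0, hNN]
    norm_num
  · simp only [eta_add_left, eta_smul_left, nx, hNx]; norm_num
  · simp only [eta_add_left, eta_smul_left, ny, hNy]; norm_num
  · simp only [eta_add_left, eta_sub_right, eta_smul_left, eta_smul_right, n0, oN, hN0, hNN]
    norm_num
  · simp only [eta_sub_left, eta_sub_right, eta_smul_left, eta_smul_right, n0, oN, hN0, hNN]
    norm_num
  · simp only [eta_sub_right, eta_smul_right, xN, x0]; norm_num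
  · simp only [eta_sub_right, eta_smul_right, yN, y0]; norm_num
  -- The sum `T + X₂` is `2 F0`, so the orientation of the frame is that of the chart at the origin.
  · have : (F0 + (1 / 2 : ℝ) • N).1 + (F0 - (1 / 2 : ℝ) • N).1 = (2 : ℝ) • F0.1 := by
      simp only [Prod.fst_add, Prod.fst_sub, two_smul]; abel
    rw [this, triple, real_inner_smul_left]
    exact mul_pos two_pos (hF.triple 0)

end IsQuasiSphere

/-! ### Boosts, rotations and the polar decomposition -/

theorem boostB_sq (w : E3) : boostB w ^ 2 = 1 + ‖w‖ ^ 2 := Real.sq_sqrt (by positivity)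

theorem boostB_pos (w : E3) : 0 < boostB w := Real.sqrt_pos.mpr (by positivity)

theorem abs_coord_lt_boostB (w : E3) (i : Fin 3) : |w i| < boostB w := by
  refine abs_lt_of_sq_lt_sq ?_ (boostB_pos w).le
  rw [boostB_sq, norm_sq_eq_sum]
  fin_cases i <;> simp <;> nlinarith [sq_nonneg (w 0), sq_nonneg (w 1), sq_nonneg (w 2)]

theorem inner_self_boost (w : E3) : inner ℝ w w = boostB w ^ 2 - 1 := by
  rw [real_inner_self_eq_norm_sq, boostB_sq]; ring

/-- The inverse of `boostW w`. -/
def boostWInv (w : E3) : Matrix (Fin 3) (Fin 3) ℝ :=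
  1 - (1 / (boostB w * (boostB w + 1))) • Matrix.vecMulVec w.ofLp w.ofLp

theorem mv_mul (A B : Matrix (Fin 3) (Fin 3) ℝ) (x : E3) : mv (A * B) x = mv A (mv B x) := by
  simp [mv, Matrix.mulVec_mulVec]

theorem mv_add (A : Matrix (Fin 3) (Fin 3) ℝ) (x y : E3) : mv A (x + y) = mv A x + mv A y := by
  simp [mv, Matrix.mulVec_add]

theorem mv_smul (A : Matrix (Fin 3) (Fin 3) ℝ) (c : ℝ) (x : E3) : mv A (c • x) = c • mv A x := by
  simp [mv, Matrix.mulVec_smul]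

theorem mv_one (x : E3) : mv 1 x = x := by simp [mv]

theorem matrix_ext_mv {A B : Matrix (Fin 3) (Fin 3) ℝ} (h : ∀ x, mv A x = mv B x) : A = B := by
  refine Matrix.ext_of_mulVec_single fun i => ?_
  have := congrArg WithLp.ofLp (h (WithLp.toLp 2 (Pi.single i 1)))
  simpa [mv] using this

theorem inner_mv_transpose (A : Matrix (Fin 3) (Fin 3) ℝ) (x y : E3) :
    inner ℝ (mv A x) y = inner ℝ x (mv Aᵀ y) := by
  simp [inner_eq_sum]; ring

theorem mv_boostW (w x : E3) :
    mv (boostW w) x = x + ((1 / (boostB w + 1)) * inner ℝ w x) • w := by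
  refine ext3 ?_ ?_ ?_ <;> simp [boostW, inner_eq_sum, Matrix.vecMulVec_apply] <;> ring

theorem mv_boostWInv (w x : E3) :
    mv (boostWInv w) x = x - ((1 / (boostB w * (boostB w + 1))) * inner ℝ w x) • w := by
  refine ext3 ?_ ?_ ?_ <;> simp [boostWInv, inner_eq_sum, Matrix.vecMulVec_apply] <;> ring

theorem mv_boostW_self (w : E3) : mv (boostW w) w = boostB w • w := by
  have := boostB_pos w
  rw [mv_boostW, inner_self_boost]
  have e : 1 / (boostB w + 1) * (boostB w ^ 2 - 1) = boostB w - 1 := by field_simp; ring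
  rw [e]; module

theorem inner_boostW_self (w x : E3) : inner ℝ w (mv (boostW w) x) = boostB w * inner ℝ w x := by
  have := boostB_pos w
  rw [mv_boostW, inner_add_right, real_inner_smul_right, inner_self_boost]
  field_simp
  ring

theorem inner_boostW (w x y : E3) :
    inner ℝ (mv (boostW w) x) y = inner ℝ x (mv (boostW w) y) := by
  rw [mv_boostW, mv_boostW, inner_add_left, inner_add_right, real_inner_smul_left,
    real_inner_smul_right, real_inner_comm w x]
  ring

/-- The identity `W² = I + w wᵀ` is the spatial block of the condition that the boost preserves `η`.
-/
theorem mv_boostW_boostW (w x : E3) :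
    mv (boostW w) (mv (boostW w) x) = x + inner ℝ w x • w := by
  have := boostB_pos w
  rw [mv_boostW w x, mv_add, mv_smul, mv_boostW_self, mv_boostW, smul_smul, add_assoc, ← add_smul]
  congr 2
  field_simp
  ring

theorem boostW_mul_inv (w : E3) : boostW w * boostWInv w = 1 := by
  have := boostB_pos w
  refine matrix_ext_mv fun x => ?_
  rw [mv_mul, mv_boostWInv, sub_eq_add_neg, ← neg_smul, mv_add, mv_smul, mv_boostW_self, mv_boostW,
    mv_one, smul_smul, add_assoc, ← add_smul]
  refine add_eq_left.mpr ?_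
  rw [smul_eq_zero]
  left
  field_simp
  ring

theorem boostWInv_mul (w : E3) : boostWInv w * boostW w = 1 :=
  mul_eq_one_comm.mp (boostW_mul_inv w)

theorem boostW_inv (w : E3) : (boostW w)⁻¹ = boostWInv w :=
  Matrix.inv_eq_right_inv (boostW_mul_inv w)

theorem eta_boost (w : E3) (p q : Mink) : eta (boost w p) (boost w q) = eta p q := by
  simp only [eta, boost, inner_add_left, inner_add_right, real_inner_smul_left,
    real_inner_smul_right]
  rw [inner_boostW, mv_boostW_boostW, inner_boostW, mv_boostW_self, inner_boostW_self,
    inner_self_boost, inner_add_right, real_inner_smul_right, real_inner_smul_right,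
    real_inner_comm w p.1]
  ring

theorem eta_rotation {R : Matrix (Fin 3) (Fin 3) ℝ} (hR : Rᵀ * R = 1) (p q : Mink) :
    eta (rotation R p) (rotation R q) = eta p q := by
  simp only [eta, rotation]
  rw [inner_mv_transpose, ← mv_mul, hR, mv_one]

theorem boost_add (w : E3) (p q : Mink) : boost w (p + q) = boost w p + boost w q := by
  refine Prod.ext ?_ ?_
  · simp only [boost, Prod.fst_add, Prod.snd_add, mv_add]; module
  · simp only [boost, Prod.fst_add, Prod.snd_add, inner_add_right]; ring

theorem boost_smul (w : E3) (c : ℝ) (p : Mink) : boost w (c • p) = c • boost w p := by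
  refine Prod.ext ?_ ?_
  · simp only [boost, Prod.smul_fst, Prod.smul_snd, mv_smul, smul_eq_mul]; module
  · simp only [boost, Prod.smul_fst, Prod.smul_snd, real_inner_smul_right, smul_eq_mul]; ring

theorem rotation_add (R : Matrix (Fin 3) (Fin 3) ℝ) (p q : Mink) :
    rotation R (p + q) = rotation R p + rotation R q := by
  simp [rotation, mv_add]

theorem rotation_smul (R : Matrix (Fin 3) (Fin 3) ℝ) (c : ℝ) (p : Mink) :
    rotation R (c • p) = c • rotation R p := by
  simp [rotation, mv_smul]

/-- The composition of a boost and a rotation, as a continuous linear map. -/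
def lorentz (R : Matrix (Fin 3) (Fin 3) ℝ) (w : E3) : Mink →L[ℝ] Mink :=
  LinearMap.toContinuousLinearMap
    { toFun := fun p => rotation R (boost w p)
      map_add' := fun p q => by rw [boost_add, rotation_add]
      map_smul' := fun c p => by rw [boost_smul, rotation_smul]; rfl }

@[simp] theorem lorentz_apply (R : Matrix (Fin 3) (Fin 3) ℝ) (w : E3) (p : Mink) :
    lorentz R w p = rotation R (boost w p) := rfl

theorem eta_lorentz {R : Matrix (Fin 3) (Fin 3) ℝ} (hR : Rᵀ * R = 1) (w : E3) (p q : Mink) :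
    eta (lorentz R w p) (lorentz R w q) = eta p q := by
  rw [lorentz_apply, lorentz_apply, eta_rotation hR, eta_boost]

/-- The rotation times boost formula in polar coordinates. -/
theorem lorentz_polar (R : Matrix (Fin 3) (Fin 3) ℝ) (w : E3) (r : ℝ) (x : E3) :
    lorentz R w (r • x, r) = (r • mv R x + (r * (1 + inner ℝ x w / (boostB w + 1))) • mv R w,
      r * (boostB w + inner ℝ x w)) := by
  simp only [lorentz_apply, rotation, boost]
  refine Prod.ext ?_ ?_
  · simp only [mv_boostW, mv_add, mv_smul, real_inner_comm w x]; module
  · simp only [real_inner_smul_right, real_inner_comm w x]; ring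

/-- The matrix with the given columns. -/
def columns (x y z : E3) : Matrix (Fin 3) (Fin 3) ℝ :=
  Matrix.of fun i j => ![x i, y i, z i] j

section polar

variable {T X Y Z : Mink}

/-- The rows of a Lorentz matrix are orthonormal. -/
theorem lorentz_rows (hTT : eta T T = -1) (hTX : eta T X = 0) (hTY : eta T Y = 0)
    (hTZ : eta T Z = 0) (hXX : eta X X = 1) (hYY : eta Y Y = 1) (hZZ : eta Z Z = 1)
    (hXY : eta X Y = 0) (hXZ : eta X Z = 0) (hYZ : eta Y Z = 0) :
    (∀ i j : Fin 3, X.1 i * X.1 j + Y.1 i * Y.1 j + Z.1 i * Z.1 j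
      = T.1 i * T.1 j + if i = j then 1 else 0) ∧
    (∀ i : Fin 3, X.1 i * X.2 + Y.1 i * Y.2 + Z.1 i * Z.2 = T.1 i * T.2) ∧
    X.2 ^ 2 + Y.2 ^ 2 + Z.2 ^ 2 = T.2 ^ 2 - 1 := by
  simp only [eta, inner_eq_sum] at *
  let K : Matrix (Fin 4) (Fin 4) ℝ := !![X.1 0, X.1 1, X.1 2, -X.2; Y.1 0, Y.1 1, Y.1 2, -Y.2;
    Z.1 0, Z.1 1, Z.1 2, -Z.2; -T.1 0, -T.1 1, -T.1 2, T.2]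
  let L : Matrix (Fin 4) (Fin 4) ℝ := !![X.1 0, Y.1 0, Z.1 0, T.1 0; X.1 1, Y.1 1, Z.1 1, T.1 1;
    X.1 2, Y.1 2, Z.1 2, T.1 2; X.2, Y.2, Z.2, T.2]
  -- `K` is the `η`-adjoint of `L`, so this encodes orthonormality of the columns; a left inverse of
  -- a square matrix is a right inverse, which gives the rows.
  have hKL : K * L = 1 := by
    ext i j
    fin_cases i <;> fin_cases j <;> simp [K, L, Matrix.mul_apply, Fin.sum_univ_four] <;> linarith
  have hLK : L * K = 1 := mul_eq_one_comm.mp hKL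
  have e : ∀ i j : Fin 4, (L * K) i j = (1 : Matrix (Fin 4) (Fin 4) ℝ) i j := fun i j => by
    rw [hLK]
  refine ⟨fun i j => ?_, fun i => ?_, ?_⟩
  · have := e i.castSucc j.castSucc
    fin_cases i <;> fin_cases j <;>
      simp [K, L, Matrix.mul_apply, Fin.sum_univ_four] at this ⊢ <;> linarith
  · have := e i.castSucc 3
    fin_cases i <;> simp [K, L, Matrix.mul_apply, Fin.sum_univ_four] at this ⊢ <;> linarith
  · have := e 3 3
    simp [K, L, Matrix.mul_apply, Fin.sum_univ_four] at this
    linarith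

/-- The polar decomposition of a proper orthochronous Lorentz transformation into a boost followed
by a rotation. -/
theorem polar_decomposition (hTT : eta T T = -1) (hTX : eta T X = 0) (hTY : eta T Y = 0)
    (hTZ : eta T Z = 0) (hXX : eta X X = 1) (hYY : eta Y Y = 1) (hZZ : eta Z Z = 1)
    (hXY : eta X Y = 0) (hXZ : eta X Z = 0) (hYZ : eta Y Z = 0) (hT : 0 < T.2)
    (htriple : 0 < triple (T.1 + Z.1) X.1 Y.1) :
    columns X.1 Y.1 Z.1 * boostWInv !₂[X.2, Y.2, Z.2] ∈ Matrix.specialOrthogonalGroup (Fin 3) ℝ ∧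
    ∀ x : E3, T + x 0 • X + x 1 • Y + x 2 • Z
      = lorentz (columns X.1 Y.1 Z.1 * boostWInv !₂[X.2, Y.2, Z.2]) !₂[X.2, Y.2, Z.2] (x, 1) := by
  obtain ⟨hMM, hMw, hww⟩ := lorentz_rows hTT hTX hTY hTZ hXX hYY hZZ hXY hXZ hYZ
  set w : E3 := !₂[X.2, Y.2, Z.2] with hw
  set M := columns X.1 Y.1 Z.1 with hM
  have w0 : w 0 = X.2 := by simp [hw]
  have w1 : w 1 = Y.2 := by simp [hw]
  have w2 : w 2 = Z.2 := by simp [hw]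
  have M0 : ∀ i, M i 0 = X.1 i := fun i => by simp [hM, columns]
  have M1 : ∀ i, M i 1 = Y.1 i := fun i => by simp [hM, columns]
  have M2 : ∀ i, M i 2 = Z.1 i := fun i => by simp [hM, columns]
  -- The time row gives `T.2² = 1 + |w|²`, and positivity of the time selects the root.
  have hb : T.2 = boostB w := by
    rw [← sq_eq_sq₀ hT.le (boostB_pos w).le, boostB_sq, norm_sq_eq_sum, w0, w1, w2]
    linarith
  have hbpos := boostB_pos w
  have hMwv : mv M w = boostB w • T.1 := by
    ext i
    rw [mv_apply, w0, w1, w2, M0, M1, M2, hMw, hb, PiLp.smul_apply, smul_eq_mul, mul_comm]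
  have hRw : mv (M * boostWInv w) w = T.1 := by
    rw [mv_mul, mv_boostWInv, sub_eq_add_neg, ← neg_smul, mv_add, mv_smul, hMwv, smul_smul,
      ← add_smul, inner_self_boost]
    convert one_smul ℝ T.1 using 2
    field_simp
    ring
  have hRW : M * boostWInv w * boostW w = M := by rw [mul_assoc, boostWInv_mul, mul_one]
  have hRent : ∀ i j, (M * boostWInv w) i j = M i j - T.1 i * w j / (boostB w + 1) := by
    intro i j
    have h1 : M i 0 * w 0 + M i 1 * w 1 + M i 2 * w 2 = boostB w * T.1 i := by
      rw [← mv_apply, hMwv]; rfl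
    have h2 : (M * boostWInv w) i j = M i j
        - (M i 0 * w 0 + M i 1 * w 1 + M i 2 * w 2) * w j / (boostB w * (boostB w + 1)) := by
      rw [boostWInv, mul_sub, mul_one, Matrix.sub_apply, Matrix.mul_smul, Matrix.smul_apply,
        Matrix.mul_apply, Fin.sum_univ_three]
      simp only [Matrix.vecMulVec_apply, smul_eq_mul]
      ring
    rw [h2, h1]
    field_simp
  have hRR : (M * boostWInv w) * (M * boostWInv w)ᵀ = 1 := by
    ext i j
    rw [Matrix.mul_apply, Fin.sum_univ_three, Matrix.one_apply]
    simp only [Matrix.transpose_apply, hRent, M0, M1, M2, w0, w1, w2]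
    rw [hb] at hww hMw
    have hb1 : boostB w + 1 ≠ 0 := by positivity
    have e1 := hMM i j
    have e2 := hMw i
    have e3 := hMw j
    set k := 1 / (boostB w + 1) with hk
    have hk1 : k * (boostB w + 1) = 1 := by rw [hk]; field_simp
    have hd : ∀ a : ℝ, a / (boostB w + 1) = a * k := fun a => by rw [hk, mul_one_div]
    simp only [hd]
    linear_combination e1 - k * T.1 j * e2 - k * T.1 i * e3 + k ^ 2 * T.1 i * T.1 j * hww
      + (T.1 i * T.1 j * k * boostB w - T.1 i * T.1 j * k - T.1 i * T.1 j) * hk1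
  -- The orientation hypothesis involves `T + Z`, but `b T` is the combination of the columns with
  -- weights `w`. Hence `(b + w₂) det M` equals `b` times the given triple product, and `|w₂| < b`.
  have hdetM : 0 < M.det := by
    have h1 : M.det = triple Z.1 X.1 Y.1 := by
      rw [Matrix.det_fin_three, triple_eq]; simp only [M0, M1, M2]; ring
    have h2 : boostB w * triple T.1 X.1 Y.1 = w 2 * M.det := by
      have e : ∀ i, boostB w * T.1 i = X.1 i * X.2 + Y.1 i * Y.2 + Z.1 i * Z.2 := fun i => by
        rw [hMw, hb, mul_comm]
      rw [h1, triple_eq, triple_eq, w2]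
      linear_combination (X.1 1 * Y.1 2 - X.1 2 * Y.1 1) * e 0
        + (X.1 2 * Y.1 0 - X.1 0 * Y.1 2) * e 1 + (X.1 0 * Y.1 1 - X.1 1 * Y.1 0) * e 2
    have h3 : triple (T.1 + Z.1) X.1 Y.1 = triple T.1 X.1 Y.1 + triple Z.1 X.1 Y.1 := by
      simp [triple, inner_add_left]
    have h4 := neg_lt_of_abs_lt (abs_coord_lt_boostB w 2)
    refine (mul_pos_iff_of_pos_left (show 0 < boostB w + w 2 by linarith)).mp ?_
    have := mul_pos hbpos htriple
    rw [h3, mul_add, h2, ← h1] at this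
    linarith
  refine ⟨?_, fun x => ?_⟩
  · rw [Matrix.mem_specialOrthogonalGroup_iff, Matrix.mem_orthogonalGroup_iff]
    refine ⟨hRR, ?_⟩
    have h1 : ((M * boostWInv w).det) ^ 2 = 1 := by
      have := congrArg Matrix.det hRR
      rw [Matrix.det_mul, Matrix.det_transpose, Matrix.det_one] at this
      rw [sq, this]
    have h2 : 0 < (M * boostWInv w).det := by
      have e1 : (boostW w).det = boostB w := by
        rw [Matrix.det_fin_three]
        have e := inner_self_boost w
        rw [inner_eq_sum] at e
        simp only [boostW, Matrix.add_apply, Matrix.smul_apply, Matrix.vecMulVec_apply,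
          Matrix.one_apply, smul_eq_mul]
        simp
        field_simp
        linear_combination (boostB w + 1) ^ 2 * e
      have := congrArg Matrix.det hRW
      rw [Matrix.det_mul, e1] at this
      rw [← this] at hdetM
      exact (mul_pos_iff_of_pos_right hbpos).mp hdetM
    nlinarith
  · rw [lorentz_apply, rotation, boost]
    refine Prod.ext ?_ ?_
    · simp only [one_smul, mv_add, ← mv_mul, hRW, hRw, Prod.fst_add, Prod.smul_fst]
      ext i
      simp only [PiLp.add_apply, PiLp.smul_apply, smul_eq_mul, mv_apply, M0, M1, M2]
      ring
    · simp only [Prod.snd_add, Prod.smul_snd, smul_eq_mul, hb, inner_eq_sum, w0, w1, w2]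
      ring

end polar

/-! ### The infinitesimal Lorentz transformation -/

/-- With this sign of the star operator a skew matrix acts by cross product from the right, which is
why `β` contains `θ × s₁`. -/
theorem mv_skew {S : Matrix (Fin 3) (Fin 3) ℝ} (hS : Sᵀ = -S) (x : E3) :
    mv S x = cross x (star3 S) := by
  have e : ∀ i j, S j i = -S i j := fun i j => congrFun (congrFun hS i) j
  have d : ∀ i, S i i = 0 := fun i => by linarith [e i i]
  refine ext3 ?_ ?_ ?_ <;> simp [star3, d, e 0 1, e 0 2, e 1 2] <;> ring

theorem inner_mv_skew {S : Matrix (Fin 3) (Fin 3) ℝ} (hS : Sᵀ = -S) (x y : E3) :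
    inner ℝ (mv S x) y = - inner ℝ x (mv S y) := by
  rw [inner_mv_transpose, hS]
  simp [inner_eq_sum]; ring

theorem cross_cross (x y z : E3) :
    cross x (cross y z) = inner ℝ x z • y - inner ℝ x y • z := by
  refine ext3 ?_ ?_ ?_ <;> simp [inner_eq_sum] <;> ring

theorem boostW_transpose (w : E3) : (boostW w)ᵀ = boostW w := by
  simp [boostW, Matrix.transpose_vecMulVec]

/-- The Maurer-Cartan form of a family of boosts and rotations, applied to the null vector
`(θ, 1)`. Here `Ω = R⁻¹ R'`, `v = w'`, and the left hand side is the derivative of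
`R⁻¹ R B(w) (θ, 1)`. -/
theorem maurerCartan {Ω : Matrix (Fin 3) (Fin 3) ℝ} (hΩ : Ωᵀ = -Ω) (w v θ s t : E3)
    (hs : s = star3 (boostW w * Ω * boostW w) + (1 / (boostB w + 1)) • cross v w)
    (ht : t = (boostB w)⁻¹ • mv (boostW w * Ω * boostW w) w + mv (boostWInv w) v) :
    (mv Ω (mv (boostW w) θ + w)
      + ((-(inner ℝ w v / boostB w) / (boostB w + 1) ^ 2 * inner ℝ w θ) • w
        + (1 / (boostB w + 1) * inner ℝ v θ) • w
        + (1 / (boostB w + 1) * inner ℝ w θ) • v + v),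
      inner ℝ v θ + inner ℝ w v / boostB w)
    = boost w (cross θ s + t, inner ℝ θ t) := by
  have hb := boostB_pos w
  have hS : (boostW w * Ω * boostW w)ᵀ = -(boostW w * Ω * boostW w) := by
    simp [Matrix.transpose_mul, boostW_transpose, hΩ, mul_assoc]
  have hΩw : mv (boostW w * Ω * boostW w) w = boostB w • mv (boostW w) (mv Ω w) := by
    rw [mv_mul, mv_boostW_self, mv_smul, mv_mul]
  have ht' : t = mv (boostW w) (mv Ω w) + mv (boostWInv w) v := by
    rw [ht, hΩw, inv_smul_smul₀ hb.ne']
  -- The correction `w' × w` in `s₁` enters through `θ × (v × w) = (θ · w) v - (θ · v) w`: it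
  -- accounts for the derivative of the factor `w wᵀ` in `W`.
  have hsθ : cross θ s = mv (boostW w) (mv Ω (mv (boostW w) θ))
      + (1 / (boostB w + 1)) • (inner ℝ w θ • v - inner ℝ v θ • w) := by
    have : cross θ s = cross θ (star3 (boostW w * Ω * boostW w))
        + (1 / (boostB w + 1)) • cross θ (cross v w) := by
      rw [hs]
      refine ext3 ?_ ?_ ?_ <;> simp <;> ring
    rw [this, ← mv_skew hS, cross_cross, mv_mul, mv_mul, real_inner_comm w θ, real_inner_comm v θ]
  set y := mv Ω (mv (boostW w) θ + w) with hy
  have hsum : cross θ s + t = mv (boostW w) y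
      + ((1 / (boostB w + 1)) • (inner ℝ w θ • v - inner ℝ v θ • w) + mv (boostWInv w) v) := by
    rw [hsθ, ht', hy, mv_add, mv_add]; abel
  -- Skewness of `Ω` gives `wᵀ Ω w = 0` and moves `Ω` onto the other factor; this links the time
  -- component to `t`.
  have hwy : inner ℝ w y = - inner ℝ θ (mv (boostW w) (mv Ω w)) := by
    have e1 : inner ℝ w (mv Ω w) = 0 := by
      have := inner_mv_skew hΩ w w
      rw [real_inner_comm] at this
      linarith
    rw [hy, mv_add, inner_add_right, e1, add_zero, ← inner_boostW,
      real_inner_comm _ (mv (boostW w) θ), inner_mv_skew hΩ, neg_neg]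
  have hVv : inner ℝ θ (mv (boostWInv w) v) = inner ℝ v θ
      - 1 / (boostB w * (boostB w + 1)) * inner ℝ w v * inner ℝ w θ := by
    rw [mv_boostWInv, inner_sub_right, real_inner_smul_right, real_inner_comm v θ,
      real_inner_comm w θ]
  have hwV : inner ℝ w (mv (boostWInv w) v) = inner ℝ w v / boostB w := by
    rw [mv_boostWInv, inner_sub_right, real_inner_smul_right, inner_self_boost]
    field_simp
    ring
  have hθt : inner ℝ θ t = - inner ℝ w y + (inner ℝ v θ
      - 1 / (boostB w * (boostB w + 1)) * inner ℝ w v * inner ℝ w θ) := by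
    rw [ht', inner_add_right, hVv, hwy, neg_neg]
  rw [boost, hsum, hθt]
  refine Prod.ext ?_ ?_
  · simp only [mv_add, mv_boostW_boostW]
    rw [← mv_mul _ (boostWInv w), boostW_mul_inv, mv_one, mv_smul, sub_eq_add_neg, ← neg_smul,
      mv_add, mv_smul, mv_smul, mv_boostW_self, mv_boostW w v]
    match_scalars <;> field_simp
    ring
  · simp only [inner_add_right, inner_boostW_self, real_inner_smul_right, inner_sub_right, hwV,
      inner_self_boost]
    field_simp
    ring

/-! ### Linear functions as spherical harmonics of degree one -/

section affine

variable {V : Type*} [NormedAddCommGroup V] [NormedSpace ℝ V]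

theorem hasFDerivAt_norm_inv {x : E3} (hx : x ≠ 0) :
    HasFDerivAt (fun x : E3 => ‖x‖⁻¹) (-(‖x‖⁻¹ ^ 3) • innerSL ℝ x) x := by
  have hx' : ‖x‖ ≠ 0 := norm_ne_zero_iff.mpr hx
  have h3 := (hasDerivAt_inv hx').comp_hasFDerivAt x (hasFDerivAt_norm hx)
  have e : -(‖x‖⁻¹ ^ 3) • innerSL ℝ x = -(‖x‖ ^ 2)⁻¹ • ‖x‖⁻¹ • innerSL ℝ x := by
    rw [smul_smul]
    congr 1
    field_simp
  rw [e]
  exact h3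

theorem radialExt_affine (c : V) (l : E3 →L[ℝ] V) {x : E3} (hx : x ≠ 0) :
    radialExt (fun θ : S2 => c + l θ) x = c + ‖x‖⁻¹ • l x := by
  rw [radialExt_of_ne _ hx, direction, map_smul]

theorem radialExt_affine_eventuallyEq (c : V) (l : E3 →L[ℝ] V) {x : E3} (hx : x ≠ 0) :
    radialExt (fun θ : S2 => c + l θ) =ᶠ[nhds x] fun x => c + ‖x‖⁻¹ • l x := by
  filter_upwards [isOpen_compl_singleton.mem_nhds hx] with y hy using radialExt_affine c l hy

theorem sphereSmooth_affine (c : V) (l : E3 →L[ℝ] V) :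
    SphereSmooth (fun θ : S2 => c + l θ) := by
  have : ContDiffOn ℝ ∞ (fun x : E3 => c + ‖x‖⁻¹ • l x) {0}ᶜ := fun x hx =>
    (contDiffAt_const.add (((contDiffAt_norm ℝ hx).inv (norm_ne_zero_iff.mpr hx)).smul
      l.contDiff.contDiffAt)).contDiffWithinAt
  exact this.congr fun x hx => radialExt_affine c l hx

theorem fderiv_radialExt_affine (c : V) (l : E3 →L[ℝ] V) {x : E3} (hx : x ≠ 0) (v : E3) :
    fderiv ℝ (radialExt (fun θ : S2 => c + l θ)) x v
      = ‖x‖⁻¹ • l v - (‖x‖⁻¹ ^ 3 * inner ℝ x v) • l x := by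
  have h := ((hasFDerivAt_norm_inv hx).smul (l.hasFDerivAt (x := x))).const_add c
  rw [(radialExt_affine_eventuallyEq c l hx).fderiv_eq,
    HasFDerivAt.fderiv (f := fun x => c + ‖x‖⁻¹ • l x) h]
  simp only [add_apply, smul_apply, ContinuousLinearMap.smulRight_apply, innerSL_apply_apply,
    smul_eq_mul]
  module

theorem sphereDeriv_affine (c : V) (l : E3 →L[ℝ] V) (θ : S2) (v : E3) :
    sphereDeriv (fun θ : S2 => c + l θ) θ v = l (tangentProj θ v) := by
  rw [sphereDeriv, fderiv_radialExt_affine c l (S2.ne_zero θ), S2.norm_eq_one, tangentProj]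
  simp

/-- Linear functions restrict to spherical harmonics of degree one. -/
theorem sphereLaplacian_linear (l : E3 →L[ℝ] ℂ) (θ : S2) :
    sphereLaplacian (fun θ : S2 => (0 : ℂ) + l θ) θ = -2 * l θ := by
  set g := radialExt (fun θ : S2 => (0 : ℂ) + l θ) with hg
  have hne := S2.ne_zero θ
  have hdd : DifferentiableAt ℝ (fderiv ℝ g) θ :=
    ((((sphereSmooth_affine 0 l).fderiv_of_isOpen (m := ∞) isOpen_compl_singleton
      (by simp)).contDiffAt (isOpen_compl_singleton.mem_nhds hne))).differentiableAt (by simp)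
  -- Second derivative of `l(x)/|x|` at a unit vector. Summed over an orthonormal basis, the
  -- coefficients of `l θ` are `3 - 3 - 2 = -2`.
  have second : ∀ e : E3, iteratedFDeriv ℝ 2 g θ ![e, e]
      = (3 * inner ℝ (θ : E3) e ^ 2 - inner ℝ e e) • l θ - (2 * inner ℝ (θ : E3) e) • l e := by
    intro e
    rw [iteratedFDeriv_two_apply]
    simp only [Matrix.cons_val_zero, Matrix.cons_val_one]
    have h1 : fderiv ℝ (fderiv ℝ g) θ e e = fderiv ℝ (fun x => fderiv ℝ g x e) θ e := by
      rw [fderiv_clm_apply hdd (differentiableAt_const e)]; simp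
    have h2 : (fun x => fderiv ℝ g x e) =ᶠ[nhds (θ : E3)]
        fun x => ‖x‖⁻¹ • l e - (‖x‖⁻¹ ^ 3 * inner ℝ x e) • l x := by
      filter_upwards [isOpen_compl_singleton.mem_nhds hne] with y hy
        using fderiv_radialExt_affine 0 l hy e
    have n1 := hasFDerivAt_norm_inv hne
    have i1 : HasFDerivAt (fun x : E3 => inner ℝ x e) (innerSL ℝ e) (θ : E3) := by
      have : (fun x : E3 => inner ℝ x e) = fun x => innerSL ℝ e x := by
        funext x; simp [real_inner_comm]
      rw [this]
      exact (innerSL ℝ e).hasFDerivAt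
    have h3 := (n1.smul_const (l e)).sub (((n1.pow 3).mul i1).smul (l.hasFDerivAt (x := (θ : E3))))
    rw [h1, h2.fderiv_eq, HasFDerivAt.fderiv
      (f := fun x : E3 => ‖x‖⁻¹ • l e - (‖x‖⁻¹ ^ 3 * inner ℝ x e) • l x) h3]
    simp [-Complex.real_smul]
    module
  rw [sphereLaplacian, ← hg, InnerProductSpace.laplacian_eq_iteratedFDeriv_orthonormalBasis g
    (EuclideanSpace.basisFun (Fin 3) ℝ)]
  simp only [second, Fin.sum_univ_three, EuclideanSpace.basisFun_apply]
  have hθ := S2.inner_self θ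
  rw [inner_eq_sum] at hθ
  have hl : l θ = (θ : E3) 0 • l (EuclideanSpace.single 0 1)
      + (θ : E3) 1 • l (EuclideanSpace.single 1 1) + (θ : E3) 2 • l (EuclideanSpace.single 2 1) := by
    rw [← map_smul, ← map_smul, ← map_smul, ← map_add, ← map_add]
    congr 1
    refine ext3 ?_ ?_ ?_ <;> simp
  have hi : ∀ i : Fin 3, inner ℝ (θ : E3) (EuclideanSpace.single i 1) = (θ : E3) i := fun i => by
    simp [EuclideanSpace.inner_single_right]
  have hj : ∀ i : Fin 3, inner ℝ (EuclideanSpace.single i (1 : ℝ) : E3)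
      (EuclideanSpace.single i 1) = 1 := fun i => by simp
  simp only [hi, hj]
  simp only [Complex.real_smul] at hl ⊢
  have hθ' : ((θ : E3) 0 : ℂ) * ((θ : E3) 0 : ℂ) + ((θ : E3) 1 : ℂ) * ((θ : E3) 1 : ℂ)
      + ((θ : E3) 2 : ℂ) * ((θ : E3) 2 : ℂ) = 1 := by exact_mod_cast hθ
  push_cast
  linear_combination 3 * l θ * hθ' + 2 * hl

end affine

/-- Spin-1 harmonics of degree one: gradients and rotated gradients of linear functions. -/
theorem isSpinOneHarmonic_of_linear (r : ℝ) (t s : E3) :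
    IsSpinOneHarmonic 1 (fun θ => r • tangentProj θ t + r • cross (θ : E3) s) := by
  have hcross : ∀ θ : S2, inner ℝ (θ : E3) (cross (θ : E3) s) = 0 := fun θ => by
    simp [inner_eq_sum]; ring
  refine ⟨fun θ => ?_, ?_⟩
  · rw [inner_add_right, real_inner_smul_right, real_inner_smul_right, inner_tangentProj, hcross]
    ring
  -- The potential is `r (t - i s) · θ`: its real part produces the gradient term and its imaginary
  -- part, after multiplication by `-i`, the rotated gradient.
  let l : E3 →L[ℝ] ℂ := Complex.ofRealCLM.comp (r • innerSL ℝ t)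
    - Complex.I • Complex.ofRealCLM.comp (r • innerSL ℝ s)
  have hl : ∀ x, l x = (r * inner ℝ t x : ℝ) - Complex.I * (r * inner ℝ s x : ℝ) := fun x => by
    simp [l]
  refine ⟨fun θ => 0 + l θ, sphereSmooth_affine 0 l, fun θ => ?_, fun θ e₁ e₂ he => ?_⟩
  · rw [sphereLaplacian_linear]
    push_cast
    ring
  · obtain ⟨h1, h2, h12, ho⟩ := he
    have n1 : e₁ 0 ^ 2 + e₁ 1 ^ 2 + e₁ 2 ^ 2 = 1 := by rw [← norm_sq_eq_sum, h1, one_pow]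
    have n2 : e₂ 0 ^ 2 + e₂ 1 ^ 2 + e₂ 2 ^ 2 = 1 := by rw [← norm_sq_eq_sum, h2, one_pow]
    rw [inner_eq_sum] at h12
    have t1 : inner ℝ (θ : E3) e₁ = 0 := by rw [← ho]; simp [inner_eq_sum]; ring
    have t2 : inner ℝ (θ : E3) e₂ = 0 := by rw [← ho]; simp [inner_eq_sum]; ring
    -- Since `θ = e₁ × e₂`, the cross product with `θ` is a quarter turn of the frame.
    have c1 : inner ℝ (cross (θ : E3) s) e₁ = - inner ℝ s e₂ := by
      rw [← ho]
      simp only [inner_eq_sum, cross_zero, cross_one, cross_two]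
      linear_combination (-(s 0 * e₂ 0 + s 1 * e₂ 1 + s 2 * e₂ 2)) * n1
        + (s 0 * e₁ 0 + s 1 * e₁ 1 + s 2 * e₁ 2) * h12
    have c2 : inner ℝ (cross (θ : E3) s) e₂ = inner ℝ s e₁ := by
      rw [← ho]
      simp only [inner_eq_sum, cross_zero, cross_one, cross_two]
      linear_combination (s 0 * e₁ 0 + s 1 * e₁ 1 + s 2 * e₁ 2) * n2
        - (s 0 * e₂ 0 + s 1 * e₂ 1 + s 2 * e₂ 2) * h12
    have p1 : tangentProj θ e₁ = e₁ := by rw [tangentProj, t1]; simp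
    have p2 : tangentProj θ e₂ = e₂ := by rw [tangentProj, t2]; simp
    have q1 : inner ℝ (tangentProj θ t) e₁ = inner ℝ t e₁ := by
      rw [tangentProj, inner_sub_left, real_inner_smul_left, t1]; ring
    have q2 : inner ℝ (tangentProj θ t) e₂ = inner ℝ t e₂ := by
      rw [tangentProj, inner_sub_left, real_inner_smul_left, t2]; ring
    rw [spinComponent, eth, sphereDeriv_affine, sphereDeriv_affine, p1, p2, hl, hl]
    simp only [inner_add_left, real_inner_smul_left, c1, c2, q1, q2]
    congr 1
    push_cast
    linear_combination (-(r * inner ℝ s e₂ : ℂ)) * Complex.I_sq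

/-! ### The radial derivative and the pulled-back form -/

theorem hasDerivAt_of_coord {f : ℝ → E3} {f' : E3} {r : ℝ}
    (h : ∀ i, HasDerivAt (fun s => f s i) (f' i) r) : HasDerivAt f f' r := by
  have h1 : HasDerivAt (fun s => (f s).ofLp) f'.ofLp r := hasDerivAt_pi.mpr h
  exact (PiLp.continuousLinearEquiv 2 ℝ fun _ : Fin 3 => ℝ).symm.hasFDerivAt.comp_hasDerivAt r h1

theorem hasDerivAt_coord {f : ℝ → E3} {f' : E3} {r : ℝ} (h : HasDerivAt f f' r) (i : Fin 3) :
    HasDerivAt (fun s => f s i) (f' i) r :=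
  (PiLp.proj 2 (fun _ : Fin 3 => ℝ) i : E3 →L[ℝ] ℝ).hasFDerivAt.comp_hasDerivAt r h

theorem hasDerivAt_mv {R : ℝ → Matrix (Fin 3) (Fin 3) ℝ} {R' : Matrix (Fin 3) (Fin 3) ℝ}
    {x : ℝ → E3} {x' : E3} {r : ℝ} (hR : ∀ i j, HasDerivAt (fun s => R s i j) (R' i j) r)
    (hx : HasDerivAt x x' r) :
    HasDerivAt (fun s => mv (R s) (x s)) (mv R' (x r) + mv (R r) x') r := by
  refine hasDerivAt_of_coord fun i => ?_
  have h := fun j => (hR i j).fun_mul (hasDerivAt_coord hx j)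
  simp only [mv_apply]
  refine (((h 0).fun_add (h 1)).fun_add (h 2)).congr_deriv ?_
  simp only [mv_apply, PiLp.add_apply]
  ring

theorem hasDerivAt_boostB {w : ℝ → E3} {v : E3} {r : ℝ} (hw : HasDerivAt w v r) :
    HasDerivAt (fun s => boostB (w s)) (inner ℝ (w r) v / boostB (w r)) r := by
  have h1 := (hw.norm_sq.const_add 1).sqrt (by positivity)
  rwa [mul_div_mul_left _ _ two_ne_zero] at h1

/-- The logarithmic derivative of a curve of orthogonal matrices is skew-symmetric. -/
theorem inv_mul_deriv_skew {R : ℝ → Matrix (Fin 3) (Fin 3) ℝ} {R' : Matrix (Fin 3) (Fin 3) ℝ}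
    {r : ℝ} (hR : ∀ i j, HasDerivAt (fun s => R s i j) (R' i j) r)
    (ho : ∀ᶠ s in nhds r, (R s)ᵀ * R s = 1) : ((R r)⁻¹ * R')ᵀ = -((R r)⁻¹ * R') := by
  have hinv : (R r)⁻¹ = (R r)ᵀ := Matrix.inv_eq_left_inv ho.self_of_nhds
  rw [hinv]
  ext i j
  have h1 : HasDerivAt (fun s => ((R s)ᵀ * R s) i j)
      (∑ k, (R' k i * R r k j + R r k i * R' k j)) r := by
    simp only [Matrix.mul_apply, Matrix.transpose_apply]
    exact HasDerivAt.fun_sum fun k _ => (hR k i).mul (hR k j)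
  have h2 : HasDerivAt (fun s => ((R s)ᵀ * R s) i j) 0 r := by
    refine (hasDerivAt_const r ((1 : Matrix (Fin 3) (Fin 3) ℝ) i j)).congr_of_eventuallyEq ?_
    filter_upwards [ho] with s hs
    rw [hs]
  have h3 := h1.unique h2
  rw [Finset.sum_add_distrib] at h3
  simp only [Matrix.transpose_apply, Matrix.neg_apply, Matrix.mul_apply]
  rw [← add_eq_zero_iff_eq_neg, ← h3, add_comm, add_comm (∑ k, R' k i * R r k j)]
  simp only [mul_comm]

/-- The radial derivative of a family of rotated and boosted spheres. -/
theorem hasDerivAt_lorentz {w : ℝ → E3} {R : ℝ → Matrix (Fin 3) (Fin 3) ℝ} {r : ℝ}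
    (hw : DifferentiableAt ℝ w r) (hR : ∀ i j, DifferentiableAt ℝ (fun s => R s i j) r)
    (ho : ∀ᶠ s in nhds r, (R s)ᵀ * R s = 1) (θ : E3) :
    HasDerivAt (fun s => lorentz (R s) (w s) (s • θ, s))
      (lorentz (R r) (w r) (θ + r • (cross θ (s₁ w R r) + t₁ w R r),
        1 + r * inner ℝ θ (t₁ w R r))) r := by
  have hw' := hw.hasDerivAt
  have hR' : ∀ i j, HasDerivAt (fun s => R s i j) (matDeriv R r i j) r :=
    fun i j => (hR i j).hasDerivAt
  have hb := hasDerivAt_boostB hw'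
  have hbpos := boostB_pos (w r)
  have hk : HasDerivAt (fun s => 1 / (boostB (w s) + 1))
      (-(inner ℝ (w r) (deriv w r) / boostB (w r)) / (boostB (w r) + 1) ^ 2) r := by
    simp only [one_div]
    exact (hb.add_const 1).inv (by positivity)
  have hi : HasDerivAt (fun s => inner ℝ (w s) θ) (inner ℝ (deriv w r) θ) r := by
    simpa using hw'.inner ℝ (hasDerivAt_const r θ)
  have hz := ((((hk.fun_mul hi).fun_smul hw').const_add θ).fun_add hw')
  have hy := hasDerivAt_mv hR' hz
  have hΩ := inv_mul_deriv_skew hR' ho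
  have hRΩ : R r * ((R r)⁻¹ * matDeriv R r) = matDeriv R r := by
    rw [← mul_assoc, Matrix.inv_eq_left_inv ho.self_of_nhds, mul_eq_one_comm.mp ho.self_of_nhds,
      one_mul]
  have key := maurerCartan hΩ (w r) (deriv w r) θ (s₁ w R r) (t₁ w R r)
    (by rw [s₁, S₁]; simp only [mul_assoc])
    (by rw [t₁, S₁, boostW_inv]; simp only [mul_assoc])
  have total := ((hasDerivAt_id' r).fun_smul hy).prodMk
    ((hasDerivAt_id' r).fun_mul (hi.fun_add hb))
  have hfun : (fun s => lorentz (R s) (w s) (s • θ, s)) = fun s => (s • mv (R s) (θ +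
      (1 / (boostB (w s) + 1) * inner ℝ (w s) θ) • w s + w s),
        s * (inner ℝ (w s) θ + boostB (w s))) := by
    funext s
    rw [lorentz_apply, rotation, boost, ← mv_boostW]
    refine Prod.ext ?_ ?_
    · simp only [mv_smul, mv_add, smul_add]
    · simp only [real_inner_smul_right]; ring
  rw [hfun]
  refine total.congr_deriv ?_
  -- The term `(θ, 1)` comes from the growth of the radius, the remainder is `r` times the
  -- Maurer-Cartan form.
  have hsplit : ((θ + r • (cross θ (s₁ w R r) + t₁ w R r), 1 + r * inner ℝ θ (t₁ w R r)) : Mink)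
      = (θ, 1) + r • (cross θ (s₁ w R r) + t₁ w R r, inner ℝ θ (t₁ w R r)) := by
    simp
  rw [hsplit, map_add, map_smul, lorentz_apply _ _ (cross _ _ + _, _), ← key, lorentz_apply]
  refine Prod.ext ?_ ?_
  · simp only [rotation, boost, Prod.fst_add, Prod.smul_fst, mv_add, ← mv_mul, hRΩ, mv_boostW,
      mv_smul, one_smul, add_smul, smul_add]
    module
  · simp only [rotation, boost, Prod.snd_add, Prod.smul_snd, smul_eq_mul]
    ring

theorem inner_shear (w : ℝ → E3) (R : ℝ → Matrix (Fin 3) (Fin 3) ℝ) (r : ℝ) (θ : S2) :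
    inner ℝ (θ : E3) (shear w R r θ) = 0 := by
  rw [shear, inner_add_right, real_inner_smul_right, inner_tangentProj, real_inner_smul_right]
  simp [inner_eq_sum]
  right
  ring

/-- The pulled-back form of a map given by rotated and boosted spheres. -/
theorem pullbackForm_eq {Φ : Cone → Cone} {w : ℝ → E3} {R : ℝ → Matrix (Fin 3) (Fin 3) ℝ}
    (hΦ : ∀ s : ℝ, 0 < s → ∀ θ : S2, (Φ (iota s θ) : Mink)
      = lorentz (R s) (w s) (s • (θ : E3), s)) {r : ℝ} (hr : 0 < r)
    (hw : DifferentiableAt ℝ w r) (hR : ∀ i j, DifferentiableAt ℝ (fun s => R s i j) r)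
    (ho : ∀ s : ℝ, 0 < s → (R s)ᵀ * R s = 1) (θ : S2) (a a' : ℝ) {v v' : E3}
    (hv : inner ℝ (θ : E3) v = 0) (hv' : inner ℝ (θ : E3) v' = 0) :
    pullbackForm Φ r θ (a, v) (a', v')
      = inner ℝ (r • v + a • shear w R r θ) (r • v' + a' • shear w R r θ) := by
  have hpos : ∀ᶠ s in nhds r, 0 < s := lt_mem_nhds hr
  have hd : deriv (fun s : ℝ => (Φ (iota s θ) : Mink)) r = lorentz (R r) (w r)
      ((θ : E3) + r • (cross (θ : E3) (s₁ w R r) + t₁ w R r),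
        1 + r * inner ℝ (θ : E3) (t₁ w R r)) := by
    refine HasDerivAt.deriv ((hasDerivAt_lorentz hw hR (hpos.mono ho) θ).congr_of_eventuallyEq ?_)
    exact hpos.mono fun s hs => hΦ s hs θ
  have hs : ∀ u : E3, inner ℝ (θ : E3) u = 0 →
      sphereDeriv (fun θ' => (Φ (iota r θ') : Mink)) θ u = lorentz (R r) (w r) (r • u, 0) := by
    intro u hu
    have e : (fun θ' : S2 => (Φ (iota r θ') : Mink)) = fun θ' : S2 => lorentz (R r) (w r) (0, r)
        + ((lorentz (R r) (w r)).comp (r • ContinuousLinearMap.inl ℝ E3 ℝ)) θ' := by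
      funext θ'
      rw [hΦ r hr, ContinuousLinearMap.comp_apply, ← map_add]
      simp
    rw [e, sphereDeriv_affine, tangentProj, hu, zero_smul, sub_zero,
      ContinuousLinearMap.comp_apply]
    congr 1
    simp
  -- In the moving frame the differential is a tangential vector plus a multiple of the null vector
  -- `(θ, 1)`. The latter is `η`-orthogonal to itself and to tangential vectors, so only `r v + c β`
  -- contributes to the metric.
  have hpolar : ∀ (c : ℝ) (u : E3), inner ℝ (θ : E3) u = 0 → polarDeriv Φ r θ c u
      = lorentz (R r) (w r) ((r • u + c • shear w R r θ)
          + (c * (1 + r * inner ℝ (θ : E3) (t₁ w R r))) • (θ : E3),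
        c * (1 + r * inner ℝ (θ : E3) (t₁ w R r))) := by
    intro c u hu
    rw [polarDeriv, hd, hs u hu, ← map_smul, ← map_add]
    congr 1
    refine Prod.ext ?_ ?_
    · simp only [Prod.fst_add, Prod.smul_fst, shear, tangentProj]
      module
    · simp
  have horth : ∀ (c : ℝ) (u : E3), inner ℝ (θ : E3) u = 0 →
      inner ℝ (θ : E3) (r • u + c • shear w R r θ) = 0 := fun c u hu => by
    rw [inner_add_right, real_inner_smul_right, real_inner_smul_right, hu, inner_shear]; ring
  have hθ := S2.inner_self θ
  rw [pullbackForm, hpolar a v hv, hpolar a' v' hv', eta_lorentz (ho r hr), eta]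
  have o1 := horth a v hv
  have o2 := horth a' v' hv'
  set x := r • v + a • shear w R r θ
  set x' := r • v' + a' • shear w R r θ
  simp only [inner_add_left (E := E3), inner_add_right (E := E3), real_inner_smul_left,
    real_inner_smul_right, o2, hθ, real_inner_comm (θ : E3) x, o1]
  ring

/-! ### Smooth dependence on the radius -/

/-- The spatial columns of the Lorentz transformations of a quasi-spherical map, as differences of
values at antipodal points. -/
def frameVec (Φ : Cone → Cone) (i : Fin 3) (r : ℝ) : Mink :=
  (2 * r)⁻¹ • ((Φ (conePoint (r • EuclideanSpace.single i 1)) : Mink)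
    - (Φ (conePoint (r • -EuclideanSpace.single i 1)) : Mink))

/-- The boost vector of a quasi-spherical map. -/
def boostVec (Φ : Cone → Cone) (r : ℝ) : E3 :=
  !₂[(frameVec Φ 0 r).2, (frameVec Φ 1 r).2, (frameVec Φ 2 r).2]

/-- The rotation of a quasi-spherical map. -/
def rotMatrix (Φ : Cone → Cone) (r : ℝ) : Matrix (Fin 3) (Fin 3) ℝ :=
  columns (frameVec Φ 0 r).1 (frameVec Φ 1 r).1 (frameVec Φ 2 r).1 * boostWInv (boostVec Φ r)

namespace IsSmoothQuasiSpherical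

variable {Φ : Cone → Cone} (h : IsSmoothQuasiSpherical Φ)
include h

theorem contDiffOn_frameVec (i : Fin 3) : ContDiffOn ℝ ∞ (frameVec Φ i) (Set.Ioi 0) := by
  have h1 : ∀ e : E3, e ≠ 0 → ContDiffOn ℝ ∞ (fun r : ℝ => (Φ (conePoint (r • e)) : Mink))
      (Set.Ioi 0) := fun e he => h.smooth.comp (t := {0}ᶜ)
        (g := fun x : E3 => (Φ (conePoint x) : Mink))
        (f := fun r : ℝ => r • e) (by fun_prop) fun r hr => smul_ne_zero (ne_of_gt hr) he
  have hne : (EuclideanSpace.single i 1 : E3) ≠ 0 := by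
    rw [← norm_ne_zero_iff]; simp
  have h2 : ContDiffOn ℝ ∞ (fun r : ℝ => (2 * r)⁻¹) (Set.Ioi 0) :=
    (contDiffOn_const.mul contDiffOn_id).inv fun r hr => mul_ne_zero two_ne_zero (ne_of_gt hr)
  exact h2.smul ((h1 _ hne).sub (h1 _ (neg_ne_zero.mpr hne)))

theorem contDiffOn_boostVec : ContDiffOn ℝ ∞ (boostVec Φ) (Set.Ioi 0) := by
  refine contDiffOn_euclidean.mpr fun i => ?_
  fin_cases i
  · simpa [boostVec] using (h.contDiffOn_frameVec 0).snd
  · simpa [boostVec] using (h.contDiffOn_frameVec 1).snd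
  · simpa [boostVec] using (h.contDiffOn_frameVec 2).snd

theorem contDiffOn_rotMatrix (i j : Fin 3) :
    ContDiffOn ℝ ∞ (fun r => rotMatrix Φ r i j) (Set.Ioi 0) := by
  have hw := contDiffOn_euclidean.mp h.contDiffOn_boostVec
  have hX := fun k => contDiffOn_euclidean.mp (h.contDiffOn_frameVec k).fst
  have hb : ContDiffOn ℝ ∞ (fun r => boostB (boostVec Φ r)) (Set.Ioi 0) :=
    (contDiffOn_const.add (h.contDiffOn_boostVec.norm_sq ℝ)).sqrt fun r _ => by positivity
  have hk : ContDiffOn ℝ ∞ (fun r => 1 / (boostB (boostVec Φ r) * (boostB (boostVec Φ r) + 1)))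
      (Set.Ioi 0) := contDiffOn_const.div (hb.mul (hb.add contDiffOn_const)) fun r _ => by
    have := boostB_pos (boostVec Φ r)
    positivity
  have hM : ∀ i j, ContDiffOn ℝ ∞ (fun r => columns (frameVec Φ 0 r).1 (frameVec Φ 1 r).1
      (frameVec Φ 2 r).1 i j) (Set.Ioi 0) := by
    intro i j
    fin_cases j
    · exact hX 0 i
    · exact hX 1 i
    · exact hX 2 i
  have hV : ∀ i j, ContDiffOn ℝ ∞ (fun r => boostWInv (boostVec Φ r) i j) (Set.Ioi 0) := by
    intro i j
    exact contDiffOn_const.sub (hk.mul ((hw i).mul (hw j)))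
  simp only [rotMatrix, Matrix.mul_apply]
  exact ContDiffOn.sum fun k _ => (hM i k).mul (hV k j)

/-- Rigidity only asserts that a frame exists at each radius. Taking differences at antipodal points
cancels `T` and identifies the spatial columns with `frameVec`, so the frame is the explicit one
already known to be smooth. -/
theorem lorentz_representation {r : ℝ} (hr : 0 < r) :
    rotMatrix Φ r ∈ Matrix.specialOrthogonalGroup (Fin 3) ℝ ∧
    ∀ θ : S2, (Φ (iota r θ) : Mink)
      = lorentz (rotMatrix Φ r) (boostVec Φ r) (r • (θ : E3), r) := by
  have hq := h.quasiSphere r hr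
  obtain ⟨T, X₀, X₁, X₂, hrep, hTT, hT0, hT1, hT2, h00, h11, h22, h01, h02, h12, htr⟩ :=
    hq.exists_lorentz_frame hr
  have hfr : ∀ i, frameVec Φ i r = ![X₀, X₁, X₂] i := by
    intro i
    have e1 := hrep ⟨EuclideanSpace.single i 1, by simp⟩
    have e2 := hrep ⟨-EuclideanSpace.single i 1, by simp⟩
    simp only [iota] at e1 e2
    rw [frameVec, e1, e2, ← smul_sub, smul_smul]
    have : (2 * r)⁻¹ * r = 1 / 2 := by field_simp
    rw [this]
    fin_cases i <;> simp <;> module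
  -- The spatial columns cancel in the sum of the values at two antipodal points, both of which have
  -- positive time.
  have hT : 0 < T.2 := by
    have e1 := hrep ⟨EuclideanSpace.single 0 1, by simp⟩
    have e2 := hrep ⟨-EuclideanSpace.single 0 1, by simp⟩
    have p1 := hq.time_pos ⟨EuclideanSpace.single 0 1, by simp⟩
    have p2 := hq.time_pos ⟨-EuclideanSpace.single 0 1, by simp⟩
    rw [e1] at p1
    rw [e2] at p2
    simp at p1 p2
    refine (mul_pos_iff_of_pos_left hr).mp ?_
    linarith
  have f0 : frameVec Φ 0 r = X₀ := hfr 0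
  have f1 : frameVec Φ 1 r = X₁ := hfr 1
  have f2 : frameVec Φ 2 r = X₂ := hfr 2
  obtain ⟨hSO, hpol⟩ := polar_decomposition hTT hT0 hT1 hT2 h00 h11 h22 h01 h02 h12 hT htr
  have hwr : boostVec Φ r = !₂[X₀.2, X₁.2, X₂.2] := by rw [boostVec, f0, f1, f2]
  have hRr : rotMatrix Φ r = columns X₀.1 X₁.1 X₂.1 * boostWInv !₂[X₀.2, X₁.2, X₂.2] := by
    rw [rotMatrix, f0, f1, f2, hwr]
  rw [hRr, hwr]
  refine ⟨hSO, fun θ => ?_⟩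
  rw [hrep θ, hpol, ← map_smul]
  simp

end IsSmoothQuasiSpherical

end NullCone

end

theorem proposition1 (Φ : NullCone.Cone → NullCone.Cone)
    (hΦ : NullCone.IsSmoothQuasiSpherical Φ) :
    ∃ (w : ℝ → NullCone.E3) (R : ℝ → Matrix (Fin 3) (Fin 3) ℝ),
      ContDiffOn ℝ ∞ w (Set.Ioi 0) ∧
      (∀ i j : Fin 3, ContDiffOn ℝ ∞ (fun r => R r i j) (Set.Ioi 0)) ∧
      (∀ r : ℝ, 0 < r → R r ∈ Matrix.specialOrthogonalGroup (Fin 3) ℝ) ∧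
      -- the map is given by Lorentz transformations depending on the radius
      (∀ (r : ℝ) (θ : NullCone.S2), 0 < r →
        (Φ (NullCone.iota r θ) : NullCone.Mink)
          = NullCone.rotation (R r) (NullCone.boost (w r) (r • (θ : NullCone.E3), r)) ∧
        (Φ (NullCone.iota r θ) : NullCone.Mink)
          = (r • NullCone.mv (R r) (θ : NullCone.E3)
              + (r * (1 + inner ℝ (θ : NullCone.E3) (w r) / (NullCone.boostB (w r) + 1)))
                • NullCone.mv (R r) (w r),
             r * (NullCone.boostB (w r) + inner ℝ (θ : NullCone.E3) (w r)))) ∧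
      -- the pulled-back form is `|r dθ + β dr|²`
      (∀ (r : ℝ) (θ : NullCone.S2), 0 < r → ∀ (a a' : ℝ) (v v' : NullCone.E3),
        inner ℝ (θ : NullCone.E3) v = 0 → inner ℝ (θ : NullCone.E3) v' = 0 →
        NullCone.pullbackForm Φ r θ (a, v) (a', v')
          = inner ℝ (r • v + a • NullCone.shear w R r θ)
              (r • v' + a' • NullCone.shear w R r θ)) ∧
      -- the shear vector is a spin-1 spherical harmonic of degree 1 at each radius
      (∀ r : ℝ, 0 < r → NullCone.IsSpinOneHarmonic 1 (NullCone.shear w R r)) := by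
  have hw := hΦ.contDiffOn_boostVec
  have hR := hΦ.contDiffOn_rotMatrix
  have hSO : ∀ r : ℝ, 0 < r →
      NullCone.rotMatrix Φ r ∈ Matrix.specialOrthogonalGroup (Fin 3) ℝ :=
    fun r hr => (hΦ.lorentz_representation hr).1
  have hrep : ∀ r : ℝ, 0 < r → ∀ θ : NullCone.S2, (Φ (NullCone.iota r θ) : NullCone.Mink)
      = NullCone.lorentz (NullCone.rotMatrix Φ r) (NullCone.boostVec Φ r)
        (r • (θ : NullCone.E3), r) := fun r hr => (hΦ.lorentz_representation hr).2
  refine ⟨NullCone.boostVec Φ, NullCone.rotMatrix Φ, hw, hR, hSO, fun r θ hr => ⟨?_, ?_⟩,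
    fun r θ hr a a' v v' hv hv' => ?_, fun r _ => NullCone.isSpinOneHarmonic_of_linear r _ _⟩
  · exact hrep r hr θ
  · rw [hrep r hr θ, NullCone.lorentz_polar]
  · have hmem : Set.Ioi 0 ∈ nhds r := Ioi_mem_nhds hr
    refine NullCone.pullbackForm_eq hrep hr ((hw.contDiffAt hmem).differentiableAt (by simp))
      (fun i j => ((hR i j).contDiffAt hmem).differentiableAt (by simp)) (fun s hs => ?_) θ a a' hv
      hv'
    have := (Matrix.mem_specialOrthogonalGroup_iff.mp (hSO s hs)).1
    exact mul_eq_one_comm.mp ((Matrix.mem_orthogonalGroup_iff _ _).mp this)
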